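/- Let $S$ be a scheme, $\mathcal S=\mathrm{Sch}/S$, and let $\tau\in\{\text{ét},\text{fppf}\}$; write $\mathcal S_\tau$ for the corresponding big site. A fibred category means a category $p:\mathcal T\to\mathcal S$ fibred in groupoids, a morphism of fibred categories is a functor over $\mathcal S$, and $\mathcal X(\mathcal A)$ denotes the category of morphisms $\mathcal A\to\mathcal X$. A fibred category $\mathcal T$ carries the topology inherited from $\mathcal S_\tau$ (a family in $\mathcal T$ is covering iff its image in $\mathcal S$ is), and it is called representable if it is equivalent over $\mathcal S$ to $\mathcal S/U$ for some object $U$ of $\mathcal S$; in that case it has a final object. For a sheaf of groups $\mathscr G$ on $\mathcal S_\tau$ put: * $\mathsf H^1_\tau(\mathcal T,\mathscr G)$ = the set of isomorphism classes of torsors over the site $\mathcal T_\tau$ under the pull-back of $\mathscr G$ to $\mathcal T$; * for $\mathcal T$ representable, $\check H^1_\tau(\mathcal T,\mathscr G)$ = the first (non-abelian) Čech cohomology of a final object $T$ of $\mathcal T$, i.e. the colimit of $\check H^1(\mathcal U,\mathscr G)$ over the coverings $\mathcal U$ of $T$ in $\mathcal T_\tau$ (for $\mathcal T=\mathcal S/U$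 this is the usual $\check H^1_\tau(U,\mathscr G)$); * for $\mathscr G$ abelian, $H^1_\tau(\mathcal T,\mathscr G)$ = the first derived functor cohomology of the pull-back of $\mathscr G$ to $\mathcal T_\tau$. All three are contravariant in $\mathcal T$. Let $\mathcal X$ and $\mathcal A$ be fibred categories, and let $q:\mathcal A\to\mathcal S$ be the structure morphism of $\mathcal A$. For $F$ one of these functors, $\mathcal X(\mathcal A)^{F(\mathcal X)}$ denotes the full subcategory of $\mathcal X(\mathcal A)$ of all $x:\mathcal A\to\mathcal X$ such that for every $A\in F(\mathcal X)$ the pull-back $F(x)(A)\in F(\mathcal A)$ lies in the image of $F(q):F(\mathcal S)\to F(\mathcal A)$. **(i)** Let $\mathscr G$ be a sheaf of groups on $\mathcal S_\tau$. If $\mathcal X$ and $\mathcal A$ are representable, then $$\mathcal X(\mathcal A)^{\mathsf H^1_\tau(\mathcal X,\mathscr G)}=\mathcal X(\mathcal A)^{\check H^1_\tau(\mathcal X,\mathscr G)}.$$ In particular, let $k$ be a number field with ring of adeles $\mathbf A_k$, and let $X$ be a variety over $k$, i.e. a separated $k$-scheme of finite type. With $S=\operatorname{Spec}k$, $\mathcal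 A=\operatorname{Spec}\mathbf A_k$ and $\mathcal X=X$, put $$X(\mathbf A_k)^{\mathrm{desc}}=\bigcap_{\mathscr G}X(\mathbf A_k)^{\mathsf H^1_{\mathrm{fppf}}(X,\mathscr G)},\qquad X(\mathbf A_k)^{\mathrm{cdesc}}=\bigcap_{G}X(\mathbf A_k)^{\check H^1_{\mathrm{fppf}}(X,G)},$$ where $\mathscr G$ runs over all sheaves of groups on $(\mathrm{Sch}/k)_{\mathrm{fppf}}$ and $G$ over all affine group schemes over $k$ (not necessarily of finite type). Then $$X(\mathbf A_k)^{\mathrm{desc}}\subseteq X(\mathbf A_k)^{\mathrm{cdesc}}.$$ **(ii)** If $\mathscr G$ is a sheaf of abelian groups on $\mathcal S_\tau$, then for all fibred categories $\mathcal X$ and $\mathcal A$ $$\mathcal X(\mathcal A)^{\mathsf H^1_\tau(\mathcal X,\mathscr G)}=\mathcal X(\mathcal A)^{H^1_\tau(\mathcal X,\mathscr G)}.$$ -/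

import Mathlib

open CategoryTheory Limits Opposite AlgebraicGeometry

universe j u v₁ u₁ v₂ u₂ v₃ u₃ w

namespace FibObs

section Fibred

variable {𝒮 : Type u₁} [Category.{v₁} 𝒮] {𝒳 : Type u₂} [Category.{v₂} 𝒳]

/-- A category over `𝒮` fibred in groupoids. -/
class IsFibredInGroupoids (p : 𝒳 ⥤ 𝒮) : Prop extends p.IsFibered where
  isIso_fiber {U : 𝒮} {a b : p.Fiber U} (f : a ⟶ b) : IsIso f

variable (p : 𝒳 ⥤ 𝒮)

lemma exists_lift [IsFibredInGroupoids p] {b : 𝒳} {U : 𝒮} (g : U ⟶ p.obj b) :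
    ∃ (a : 𝒳) (φ : a ⟶ b) (e : p.obj a ≅ U), p.map φ = e.hom ≫ g := by
  obtain ⟨a, φ, h⟩ := Functor.IsPreFibered.exists_isCartesian' (p := p) g
  have h1 := IsHomLift.domain_eq p g φ
  exact ⟨a, φ, eqToIso h1, by simpa using IsHomLift.fac' p g φ⟩

lemma isCartesian_map [IsFibredInGroupoids p] {a b : 𝒳} (φ : a ⟶ b) :
    p.IsCartesian (p.map φ) φ := by
  obtain ⟨c, ψ, hψ⟩ := Functor.IsPreFibered.exists_isCartesian' (p := p) (p.map φ)
  let χ := Functor.IsCartesian.map p (p.map φ) ψ φ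
  have hχ : p.IsHomLift (𝟙 (p.obj a)) χ := inferInstance
  have hfac : χ ≫ ψ = φ := Functor.IsCartesian.fac p (p.map φ) ψ φ
  have hdom : p.obj c = p.obj a := IsHomLift.domain_eq p (p.map φ) ψ
  let A : p.Fiber (p.obj a) := ⟨a, rfl⟩
  let B : p.Fiber (p.obj a) := ⟨c, hdom⟩
  let f : A ⟶ B := ⟨χ, hχ⟩
  have : IsIso f := IsFibredInGroupoids.isIso_fiber f
  let e : a ≅ c := Functor.Fiber.fiberInclusion.mapIso (asIso f)
  have he : e.hom = χ := rfl
  have : p.IsHomLift (𝟙 (p.obj a)) e.hom := hχ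
  rw [← hfac, ← he]
  have := Functor.IsCartesian.of_iso_comp p (p.map φ) ψ e
  have h2 : p.map (e.hom ≫ ψ) = p.map φ := by rw [he, hfac]
  rw [h2]
  exact this

lemma exists_factor [IsFibredInGroupoids p] {a b c : 𝒳} (φ : a ⟶ b) (ψ : c ⟶ b)
    (g : p.obj c ⟶ p.obj a) (h : g ≫ p.map φ = p.map ψ) :
    ∃ χ : c ⟶ a, χ ≫ φ = ψ ∧ p.map χ = g := by
  have := isCartesian_map p φ
  obtain ⟨χ, ⟨h1, h2⟩, -⟩ := Functor.IsStronglyCartesian.universal_property p (p.map φ) φ g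
    (p.map ψ) h.symm ψ
  exact ⟨χ, h2, (IsHomLift.eq_of_isHomLift p g χ).symm⟩

end Fibred

section Topology

variable {𝒮 : Type u₁} [Category.{v₁} 𝒮] {𝒳 : Type u₂} [Category.{v₂} 𝒳]

lemma pullback_functorPushforward_le (p : 𝒳 ⥤ 𝒮) [IsFibredInGroupoids p] {x y : 𝒳}
    (R : Sieve x) (f : y ⟶ x) :
    (R.functorPushforward p).pullback (p.map f) ≤ (R.pullback f).functorPushforward p := by
  rintro U g ⟨z, r, h, hr, hg⟩
  obtain ⟨y', φ, e, hφ⟩ := exists_lift p g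
  obtain ⟨χ, hχ, -⟩ := exists_factor p r (φ ≫ f) (e.hom ≫ h) (by
    rw [Category.assoc, ← hg, p.map_comp, hφ, Category.assoc])
  refine ⟨y', φ, e.inv, ?_, by simp [hφ]⟩
  change R (φ ≫ f)
  rw [← hχ]
  exact R.downward_closed hr χ

/-- The topology inherited from `J` by a category `p : 𝒳 ⥤ 𝒮` fibred in groupoids: a sieve on `x`
is covering if and only if the arrows `p.map f`, for `f` in the sieve, generate a covering sieve
of `p.obj x` (every arrow of `𝒳` being strongly cartesian). -/
def inheritedTopology (J : GrothendieckTopology 𝒮) (p : 𝒳 ⥤ 𝒮) [IsFibredInGroupoids p] :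
    GrothendieckTopology 𝒳 where
  sieves x := {R | R.functorPushforward p ∈ J (p.obj x)}
  top_mem' x := by
    change Sieve.functorPushforward p ⊤ ∈ J _
    rw [Sieve.functorPushforward_top]
    exact J.top_mem _
  pullback_stable' x y R f hR :=
    J.superset_covering (pullback_functorPushforward_le p R f) (J.pullback_stable (p.map f) hR)
  transitive' x R hR R' h := by
    refine J.transitive hR _ ?_
    rintro U g ⟨z, r, k, hr, rfl⟩
    rw [Sieve.pullback_comp]
    refine J.pullback_stable k (J.superset_covering ?_ (h hr))
    rintro V l ⟨a, s, m, hs, rfl⟩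
    exact ⟨a, s ≫ r, m, hs, by simp⟩

variable {𝒴 : Type u₃} [Category.{v₃} 𝒴]

lemma mem_inheritedTopology {J : GrothendieckTopology 𝒮} {p : 𝒳 ⥤ 𝒮} [IsFibredInGroupoids p]
    {x : 𝒳} {R : Sieve x} :
    R ∈ inheritedTopology J p x ↔ R.functorPushforward p ∈ J (p.obj x) := Iff.rfl

lemma isCocontinuous_inherited (J : GrothendieckTopology 𝒮) (q : 𝒴 ⥤ 𝒮) (p : 𝒳 ⥤ 𝒮)
    [IsFibredInGroupoids q] [IsFibredInGroupoids p] (F : 𝒴 ⥤ 𝒳) (h : F ⋙ p = q) :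
    F.IsCocontinuous (inheritedTopology J q) (inheritedTopology J p) where
  cover_lift {y R} hR := by
    subst h
    refine J.superset_covering ?_ hR
    rintro U g ⟨d, r, k, hr, hg⟩
    obtain ⟨c, φ, e, hφ⟩ := exists_lift (F ⋙ p) (b := y) g
    obtain ⟨χ, hχ, -⟩ := exists_factor p r (F.map φ) (e.hom ≫ k) (by
      rw [Category.assoc, ← hg]; exact hφ.symm)
    refine ⟨c, φ, e.inv, ?_, ?_⟩
    · change R (F.map φ)
      rw [← hχ]
      exact R.downward_closed hr χ
    · rw [hφ, Iso.inv_hom_id_assoc]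

lemma isContinuous_inherited (J : GrothendieckTopology 𝒮) (q : 𝒴 ⥤ 𝒮) (p : 𝒳 ⥤ 𝒮)
    [IsFibredInGroupoids q] [IsFibredInGroupoids p] (F : 𝒴 ⥤ 𝒳) (h : F ⋙ p = q) :
    F.IsContinuous (inheritedTopology J q) (inheritedTopology J p) := by
  subst h
  have push {y : 𝒴} (R : Sieve y) (hR : R ∈ inheritedTopology J (F ⋙ p) y) :
      R.functorPushforward F ∈ inheritedTopology J p (F.obj y) := by
    rw [mem_inheritedTopology] at hR ⊢
    rwa [← Sieve.functorPushforward_comp]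
  have : Functor.PreservesOneHypercovers.{max u₃ v₃} F (inheritedTopology J (F ⋙ p))
      (inheritedTopology J p) := by
    intro X E
    refine ⟨?_, ?_⟩
    · rw [PreOneHypercover.sieve₀_map]
      exact push _ E.mem₀
    · intro i₁ i₂ W p₁ p₂ hw
      change W ⟶ F.obj (E.X i₁) at p₁
      change W ⟶ F.obj (E.X i₂) at p₂
      obtain ⟨c, q₁, e, he⟩ := exists_lift (F ⋙ p) (b := E.X i₁) (p.map p₁)
      obtain ⟨q₂, hq₂, hq₂'⟩ := exists_factor (F ⋙ p) (E.f i₂) (q₁ ≫ E.f i₁) (e.hom ≫ p.map p₂) (by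
        change _ ≫ p.map (F.map _) = p.map (F.map (_ ≫ _))
        rw [Category.assoc, ← p.map_comp, ← hw, F.map_comp, p.map_comp, p.map_comp]
        erw [he]
        rw [Category.assoc])
      -- the isomorphism `W ≅ F c`
      obtain ⟨θ, hθ, hθ'⟩ := exists_factor p (F.map q₁) p₁ e.inv (by
        erw [he]; simp)
      have hθ₂ : θ ≫ F.map q₂ = p₂ := by
        have := isCartesian_map p (F.map (E.f i₂))
        have hun := Functor.IsStronglyCartesian.universal_property p (p.map (F.map (E.f i₂)))
          (F.map (E.f i₂)) (p.map p₂) (p.map (p₂ ≫ F.map (E.f i₂))) (by simp)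
          (p₂ ≫ F.map (E.f i₂))
        refine hun.unique ⟨?_, ?_⟩ ⟨inferInstance, rfl⟩
        · have : p.map (θ ≫ F.map q₂) = p.map p₂ := by
            rw [p.map_comp, hθ']
            erw [hq₂']
            simp
          rw [← this]
          infer_instance
        · rw [Category.assoc, ← F.map_comp, hq₂, F.map_comp, reassoc_of% hθ]
          exact hw
      refine (inheritedTopology J p).superset_covering ?_
        ((inheritedTopology J p).pullback_stable θ
          (push _ (E.mem₁ i₁ i₂ q₁ q₂ hq₂.symm)))
      refine le_trans (Sieve.pullback_monotone θ
        (PreOneHypercover.functorPushforward_sieve₁_map_le F q₁ q₂)) ?_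
      rintro Z g ⟨k, l, h₁, h₂⟩
      refine ⟨k, l, ?_, ?_⟩
      · rw [← hθ]; exact (Category.assoc _ _ _).symm.trans h₁
      · rw [← hθ₂]; exact (Category.assoc _ _ _).symm.trans h₂
  infer_instance

end Topology

section Torsors

variable {C : Type u₁} [Category.{v₁} C]

/-- A (right) torsor over the site `(C, J)` under a sheaf of groups `G`: a sheaf of sets `Y` with a
right action of `G` such that `Y × G ⟶ Y × Y`, `(y, g) ↦ (y, y g)`, is an isomorphism and such
that `Y` is locally non-empty, that is, the map from `Y` to the final sheaf is an epimorphism. -/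
structure Torsor (J : GrothendieckTopology C) (G : Cᵒᵖ ⥤ GrpCat.{w}) where
  sheaf : Sheaf J (Type w)
  act {U : C} : sheaf.obj.obj (op U) → G.obj (op U) → sheaf.obj.obj (op U)
  act_one {U : C} (y : sheaf.obj.obj (op U)) : act y 1 = y
  act_mul {U : C} (y : sheaf.obj.obj (op U)) (g h : G.obj (op U)) :
    act y (g * h) = act (act y g) h
  map_act {U V : C} (f : V ⟶ U) (y : sheaf.obj.obj (op U)) (g : G.obj (op U)) :
    sheaf.obj.map f.op (act y g) = act (sheaf.obj.map f.op y) (G.map f.op g)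
  bijective (U : C) : Function.Bijective
    (fun z : sheaf.obj.obj (op U) × G.obj (op U) ↦ (z.1, act z.1 z.2))
  locally_nonempty (U : C) : ∃ R ∈ J U, ∀ ⦃V : C⦄ (f : V ⟶ U), R f →
    Nonempty (sheaf.obj.obj (op V))

namespace Torsor

variable {J : GrothendieckTopology C} {G : Cᵒᵖ ⥤ GrpCat.{w}}

/-- Two torsors are isomorphic if there is a `G`-equivariant isomorphism of sheaves. -/
def IsIsomorphic (P Q : Torsor J G) : Prop :=
  ∃ e : P.sheaf ≅ Q.sheaf, ∀ (U : C) (y : P.sheaf.obj.obj (op U)) (g : G.obj (op U)),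
    e.hom.hom.app (op U) (P.act y g) = Q.act (e.hom.hom.app (op U) y) g

variable (J G) in
lemma isIsomorphic_equivalence : Equivalence (IsIsomorphic (J := J) (G := G)) where
  refl P := ⟨Iso.refl _, fun _ _ _ ↦ rfl⟩
  symm := by
    rintro P Q ⟨e, h⟩
    have h₁ (U : C) (y : P.sheaf.obj.obj (op U)) :
        e.inv.hom.app (op U) (e.hom.hom.app (op U) y) = y :=
      congr_arg (fun a ↦ a.hom.app (op U) y) e.hom_inv_id
    have h₂ (U : C) (y : Q.sheaf.obj.obj (op U)) :
        e.hom.hom.app (op U) (e.inv.hom.app (op U) y) = y :=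
      congr_arg (fun a ↦ a.hom.app (op U) y) e.inv_hom_id
    refine ⟨e.symm, fun U y g ↦ ?_⟩
    change e.inv.hom.app (op U) (Q.act y g) = P.act (e.inv.hom.app (op U) y) g
    conv_lhs => rw [← h₂ U y, ← h, h₁]
  trans := by
    rintro P Q R ⟨e, h⟩ ⟨e', h'⟩
    refine ⟨e ≪≫ e', fun U y g ↦ ?_⟩
    change e'.hom.hom.app (op U) (e.hom.hom.app (op U) _) =
      R.act (e'.hom.hom.app (op U) (e.hom.hom.app (op U) y)) g
    rw [h, h']

variable (J G) in
instance setoid : Setoid (Torsor J G) := ⟨IsIsomorphic, isIsomorphic_equivalence J G⟩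

variable {D : Type u₂} [Category.{v₂} D] {K : GrothendieckTopology D} {H : Dᵒᵖ ⥤ GrpCat.{w}}

/-- The pull-back of a torsor along a (continuous and cocontinuous) functor `F`, the pulled back
group `F.op ⋙ G` being identified with `H`. -/
def pullback (F : D ⥤ C) [F.IsContinuous K J] [F.IsCocontinuous K J] (φ : F.op ⋙ G ≅ H)
    (P : Torsor J G) : Torsor K H where
  sheaf := (F.sheafPushforwardContinuous (Type w) K J).obj P.sheaf
  act {U} y g := P.act (U := F.obj U) y (φ.inv.app (op U) g)
  act_one {U} y := by rw [map_one]; exact P.act_one _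
  act_mul {U} y g h := by rw [map_mul]; exact P.act_mul _ _ _
  map_act {U V} f y g := by
    refine (P.map_act (F.map f) _ _).trans ?_
    congr 1
    exact (ConcreteCategory.congr_hom (φ.inv.naturality f.op) g).symm
  bijective U := by
    have hφ : Function.Bijective (fun g : H.obj (op U) ↦ φ.inv.app (op U) g) :=
      ConcreteCategory.bijective_of_isIso (φ.inv.app (op U))
    exact (P.bijective (F.obj U)).comp (Function.bijective_id.prodMap hφ)
  locally_nonempty U := by
    obtain ⟨R, hR, h⟩ := P.locally_nonempty (F.obj U)
    exact ⟨R.functorPullback F, F.cover_lift K J hR, fun V f hf ↦ h (F.map f) hf⟩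

end Torsor

/-- The set of isomorphism classes of `G`-torsors over the site `(C, J)`. -/
def TorsorClasses (J : GrothendieckTopology C) (G : Cᵒᵖ ⥤ GrpCat.{w}) :
    Type max u₁ v₁ (w + 1) :=
  Quotient (Torsor.setoid J G)

/-- The pull-back map `[P] ↦ [F^* P]` on isomorphism classes of torsors. -/
def TorsorClasses.map {J : GrothendieckTopology C} {G : Cᵒᵖ ⥤ GrpCat.{w}}
    {D : Type u₂} [Category.{v₂} D] {K : GrothendieckTopology D} {H : Dᵒᵖ ⥤ GrpCat.{w}}
    (F : D ⥤ C) [F.IsContinuous K J] [F.IsCocontinuous K J] (φ : F.op ⋙ G ≅ H) :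
    TorsorClasses J G → TorsorClasses K H :=
  Quotient.map (Torsor.pullback F φ) (by
    rintro P Q ⟨e, h⟩
    exact ⟨(F.sheafPushforwardContinuous (Type w) K J).mapIso e,
      fun U y g ↦ h (F.obj U) y (φ.inv.app (op U) g)⟩)

end Torsors

section Cech

variable {C : Type u₁} [Category.{v₁} C]

/-- A covering `{X i ⟶ T}` of the object `T` of the site `(C, J)`. -/
structure Covering (J : GrothendieckTopology C) (T : C) where
  I : Type j
  X : I → C
  π (i : I) : X i ⟶ T
  mem : Sieve.ofArrows X π ∈ J T

namespace Covering

variable {J : GrothendieckTopology C} {T : C}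

/-- Čech 1-cocycles of the covering `𝒰` of `T` with values in `G`: they are computed in the
localized category `C / T`, whose products are the fibre products over `T`. -/
abbrev Cocycle (𝒰 : Covering.{j} J T) (G : Cᵒᵖ ⥤ GrpCat.{w}) :=
  PresheafOfGroups.OneCocycle ((Over.forget T).op ⋙ G) (fun i ↦ Over.mk (𝒰.π i))

/-- A refinement `𝒱 ⟶ 𝒰` of coverings of `T`. -/
structure Refinement (𝒱 𝒰 : Covering.{j} J T) where
  idx : 𝒱.I → 𝒰.I
  hom (i : 𝒱.I) : 𝒱.X i ⟶ 𝒰.X (idx i)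
  w (i : 𝒱.I) : hom i ≫ 𝒰.π (idx i) = 𝒱.π i

/-- The arrow of `C / T` underlying a refinement. -/
def Refinement.overHom {𝒱 𝒰 : Covering.{j} J T} (r : Refinement 𝒱 𝒰) (i : 𝒱.I) :
    Over.mk (𝒱.π i) ⟶ Over.mk (𝒰.π (r.idx i)) :=
  Over.homMk (r.hom i) (r.w i)

/-- Restriction of a cocycle along a refinement. -/
def Cocycle.refine {𝒱 𝒰 : Covering.{j} J T} {G : Cᵒᵖ ⥤ GrpCat.{w}} (c : 𝒰.Cocycle G)
    (r : Refinement 𝒱 𝒰) : 𝒱.Cocycle G where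
  ev i j _ a b := c.ev (r.idx i) (r.idx j) (a ≫ r.overHom i) (b ≫ r.overHom j)
  ev_precomp i j T T' φ a b := by
    rw [c.ev_precomp, Category.assoc, Category.assoc]
  ev_trans i j k _ a b d := c.ev_trans _ _ _ _ _ _

/-- Two cocycles, on two coverings of `T`, define the same class in the colimit if they become
cohomologous on a common refinement. -/
def CechRel (J : GrothendieckTopology C) (G : Cᵒᵖ ⥤ GrpCat.{w}) (T : C)
    (x y : Σ 𝒰 : Covering.{j} J T, 𝒰.Cocycle G) : Prop :=
  ∃ (𝒲 : Covering.{j} J T) (r : Refinement 𝒲 x.1) (s : Refinement 𝒲 y.1),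
    PresheafOfGroups.OneCocycle.IsCohomologous (Cocycle.refine x.2 r) (Cocycle.refine y.2 s)

variable {D : Type u₂} [Category.{v₂} D] {K : GrothendieckTopology D}

/-- The index set of the pull-back of a covering of `T` along a functor `F` and an arrow
`t : F.obj T' ⟶ T`: an arrow `v : V ⟶ T'`, an index `i` of the covering, and a factorization of
`F.map v ≫ t` through the `i`-th member of the covering. -/
structure PullbackIndex (F : D ⥤ C) {T' : D} (t : F.obj T' ⟶ T) (𝒰 : Covering.{j} J T) where
  i : 𝒰.I
  V : D
  v : V ⟶ T'
  s : F.obj V ⟶ 𝒰.X i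
  w : s ≫ 𝒰.π i = F.map v ≫ t

/-- The pull-back of a covering of `T` along a cocontinuous functor `F` and an arrow
`t : F.obj T' ⟶ T`, consisting of all arrows `v : V ⟶ T'` such that `F.map v ≫ t` factors
through a member of the covering (each of them repeated for every such factorization). -/
abbrev pullback (K : GrothendieckTopology D) (F : D ⥤ C) [F.IsCocontinuous K J] {T' : D}
    (t : F.obj T' ⟶ T) (𝒰 : Covering.{j} J T) : Covering.{max j u₂ v₂ v₁} K T' where
  I := PullbackIndex F t 𝒰
  X k := k.V
  π k := k.v
  mem := by
    refine K.superset_covering ?_ (F.cover_lift K J (J.pullback_stable t 𝒰.mem))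
    rintro V v ⟨W, a, b, ⟨i⟩, h⟩
    exact Sieve.ofArrows_mk (fun k : PullbackIndex F t 𝒰 ↦ k.V) (fun k ↦ k.v) ⟨i, V, v, a, h⟩

variable {G : Cᵒᵖ ⥤ GrpCat.{w}} {H : Dᵒᵖ ⥤ GrpCat.{w}}

/-- The arrow over `T` induced by an arrow over `T'` with target a member of the pulled back
covering. -/
def pullbackHom (F : D ⥤ C) {T' : D} (t : F.obj T' ⟶ T) (𝒰 : Covering.{j} J T)
    (k : PullbackIndex F t 𝒰) {W : Over T'} (a : W ⟶ Over.mk k.v) :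
    Over.mk (F.map W.hom ≫ t) ⟶ Over.mk (𝒰.π k.i) :=
  Over.homMk (F.map a.left ≫ k.s) (by
    have h : a.left ≫ k.v = W.hom := Over.w a
    dsimp
    rw [Category.assoc, k.w, ← Category.assoc, ← F.map_comp, h])

/-- The arrow over `T` induced by an arrow over `T'`. -/
def pullbackMap (F : D ⥤ C) {T' : D} (t : F.obj T' ⟶ T) {W W' : Over T'} (f : W ⟶ W') :
    Over.mk (F.map W.hom ≫ t) ⟶ Over.mk (F.map W'.hom ≫ t) :=
  Over.homMk (F.map f.left) (by
    dsimp
    rw [← Category.assoc, ← F.map_comp, Over.w f])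

lemma pullbackMap_comp (F : D ⥤ C) {T' : D} (t : F.obj T' ⟶ T) (𝒰 : Covering.{j} J T)
    (k : PullbackIndex F t 𝒰) {W W' : Over T'} (f : W ⟶ W') (a : W' ⟶ Over.mk k.v) :
    pullbackMap F t f ≫ pullbackHom F t 𝒰 k a = pullbackHom F t 𝒰 k (f ≫ a) := by
  ext
  simp [pullbackMap, pullbackHom]

/-- The pull-back of a Čech cocycle. -/
def Cocycle.pullback (K : GrothendieckTopology D) (F : D ⥤ C) [F.IsCocontinuous K J]
    (φ : F.op ⋙ G ≅ H) {T' : D} (t : F.obj T' ⟶ T) {𝒰 : Covering.{j} J T} (c : 𝒰.Cocycle G) :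
    (pullback K F t 𝒰).Cocycle H where
  ev k l W a b := φ.hom.app (op W.left)
    (c.ev k.i l.i (T := Over.mk (F.map W.hom ≫ t)) (pullbackHom F t 𝒰 k a) (pullbackHom F t 𝒰 l b))
  ev_precomp k l W W' f a b := by
    have h := c.ev_precomp k.i l.i (pullbackMap F t f) (pullbackHom F t 𝒰 k a)
      (pullbackHom F t 𝒰 l b)
    rw [pullbackMap_comp, pullbackMap_comp] at h
    rw [← h]
    exact (ConcreteCategory.congr_hom (φ.hom.naturality f.left.op) _).symm
  ev_trans k l m W a b d := by
    refine (map_mul (φ.hom.app (op W.left)).hom _ _).symm.trans ?_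
    exact congr_arg (φ.hom.app (op W.left)) (c.ev_trans _ _ _ _ _ _)

/-- The refinement of pulled back coverings induced by a refinement. -/
def Refinement.pullback (K : GrothendieckTopology D) (F : D ⥤ C) [F.IsCocontinuous K J] {T' : D}
    (t : F.obj T' ⟶ T) {𝒱 𝒰 : Covering.{j} J T} (r : Refinement 𝒱 𝒰) :
    Refinement (pullback K F t 𝒱) (pullback K F t 𝒰) where
  idx k := ⟨r.idx k.i, k.V, k.v, k.s ≫ r.hom k.i, by rw [Category.assoc, r.w, k.w]⟩
  hom k := 𝟙 k.V
  w k := Category.id_comp _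

lemma Refinement.pullbackHom_comp (K : GrothendieckTopology D) (F : D ⥤ C)
    [F.IsCocontinuous K J] {T' : D} (t : F.obj T' ⟶ T) {𝒱 𝒰 : Covering.{j} J T}
    (r : Refinement 𝒱 𝒰) (k : PullbackIndex F t 𝒱) {W : Over T'} (a : W ⟶ Over.mk k.v) :
    pullbackHom F t 𝒰 ((r.pullback K F t).idx k) (a ≫ (r.pullback K F t).overHom k) =
      pullbackHom F t 𝒱 k a ≫ r.overHom k.i := by
  ext
  simp [pullbackHom, Refinement.overHom, Refinement.pullback]

lemma CechRel.pullback (K : GrothendieckTopology D) (F : D ⥤ C) [F.IsCocontinuous K J]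
    (φ : F.op ⋙ G ≅ H) {T' : D} (t : F.obj T' ⟶ T) {𝒰 𝒱 : Covering.{j} J T}
    (c : 𝒰.Cocycle G) (d : 𝒱.Cocycle G) (h : CechRel J G T ⟨𝒰, c⟩ ⟨𝒱, d⟩) :
    CechRel K H T' ⟨Covering.pullback K F t 𝒰, c.pullback K F φ t⟩
      ⟨Covering.pullback K F t 𝒱, d.pullback K F φ t⟩ := by
  obtain ⟨𝒲, r, s, α, h⟩ := h
  refine ⟨Covering.pullback K F t 𝒲, r.pullback K F t, s.pullback K F t,
    fun k ↦ φ.hom.app (op k.V) (G.map k.s.op (α k.i)), fun k l W a b ↦ ?_⟩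
  have key := h k.i l.i (T := Over.mk (F.map W.hom ≫ t)) (pullbackHom F t 𝒲 k a)
    (pullbackHom F t 𝒲 l b)
  have nat (m : PullbackIndex F t 𝒲) (z : W ⟶ Over.mk m.v) :
      H.map z.left.op (φ.hom.app (op m.V) (G.map m.s.op (α m.i))) =
        φ.hom.app (op W.left) (G.map (pullbackHom F t 𝒲 m z).left.op (α m.i)) := by
    refine (ConcreteCategory.congr_hom (φ.hom.naturality z.left.op) _).symm.trans ?_
    refine congr_arg (φ.hom.app (op W.left)) ?_
    exact (ConcreteCategory.congr_hom (G.map_comp m.s.op (F.map z.left).op) (α m.i)).symm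
  refine (congr_arg₂ (fun x y : H.obj (op W.left) ↦ x * y) (nat k a) rfl).trans
    (Eq.trans ?_ (congr_arg₂ (fun x y : H.obj (op W.left) ↦ x * y) rfl (nat l b)).symm)
  refine (map_mul (φ.hom.app (op W.left)).hom _ _).symm.trans
    (Eq.trans ?_ (map_mul (φ.hom.app (op W.left)).hom _ _))
  refine congr_arg (φ.hom.app (op W.left)).hom ?_
  rw [Refinement.pullbackHom_comp, Refinement.pullbackHom_comp, Refinement.pullbackHom_comp,
    Refinement.pullbackHom_comp]
  exact key

end Covering

/-- The first (non-abelian) Čech cohomology `Ȟ¹(C / T, G)` of an object `T` of the site `(C, J)`: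
the colimit, over the coverings `𝒰` of `T`, of the sets `Ȟ¹(𝒰 / T, G)` of cohomology classes of
Čech 1-cocycles of `𝒰`. -/
def CechH1 (J : GrothendieckTopology C) (G : Cᵒᵖ ⥤ GrpCat.{w}) (T : C) :
    Type max u₁ v₁ w (j + 1) :=
  Quot (Covering.CechRel.{j} J G T)

/-- The pull-back map in Čech cohomology. -/
def CechH1.map {J : GrothendieckTopology C} {G : Cᵒᵖ ⥤ GrpCat.{w}}
    {D : Type u₂} [Category.{v₂} D] {K : GrothendieckTopology D} {H : Dᵒᵖ ⥤ GrpCat.{w}}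
    (F : D ⥤ C) [F.IsCocontinuous K J] (φ : F.op ⋙ G ≅ H) {T : C} {T' : D}
    (t : F.obj T' ⟶ T) :
    CechH1.{j} J G T → CechH1.{max j u₂ v₂ v₁} K H T' :=
  Quot.map (fun x ↦ ⟨Covering.pullback K F t x.1, Covering.Cocycle.pullback K F φ t x.2⟩)
    (fun x y h ↦ Covering.CechRel.pullback K F φ t x.2 y.2 h)

end Cech

section FibredCategories

variable {𝒮 : Type u₁} [Category.{v₁} 𝒮]

lemma IsFibredInGroupoids.of_exists {𝒳 : Type u₂} [Category.{v₂} 𝒳] (p : 𝒳 ⥤ 𝒮)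
    (h : ∀ (b : 𝒳) (U : 𝒮) (f : U ⟶ p.obj b), ∃ (a : 𝒳) (e : p.obj a = U) (φ : a ⟶ b),
      p.map φ = eqToHom e ≫ f)
    (h' : ∀ (a b c : 𝒳) (φ : a ⟶ b) (ψ : c ⟶ b) (g : p.obj c ⟶ p.obj a),
      g ≫ p.map φ = p.map ψ → ∃! χ : c ⟶ a, p.map χ = g ∧ χ ≫ φ = ψ) :
    IsFibredInGroupoids p where
  toIsFibered := by
    refine Functor.IsFibered.of_exists_isStronglyCartesian fun b U f ↦ ?_
    obtain ⟨a, rfl, φ, hφ⟩ := h b U f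
    obtain rfl : p.map φ = f := by simpa using hφ
    refine ⟨a, φ, ⟨fun {c} g ψ hψ ↦ ?_⟩⟩
    obtain ⟨χ, h₁, h₂⟩ := h' a b c φ ψ g (IsHomLift.eq_of_isHomLift p _ ψ)
    refine ⟨χ, ⟨?_, h₁.2⟩, fun χ' hχ' ↦ h₂ _ ⟨?_, hχ'.2⟩⟩
    · rw [← h₁.1]; infer_instance
    · have := hχ'.1
      exact (IsHomLift.eq_of_isHomLift p g χ').symm
  isIso_fiber {U a b} f := by
    obtain ⟨a, rfl⟩ := a
    obtain ⟨b, hb⟩ := b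
    have hf := f.2
    have hf' : p.map f.1 = eqToHom hb.symm := by
      simpa using IsHomLift.fac' p (𝟙 (p.obj a)) f.1
    obtain ⟨χ, ⟨h₁, h₂⟩, -⟩ := h' a b b f.1 (𝟙 b) (eqToHom hb) (by
      rw [hf', eqToHom_trans, eqToHom_refl, p.map_id])
    have h₃ : f.1 ≫ χ = 𝟙 a := by
      obtain ⟨z, -, hz⟩ := h' a b a f.1 f.1 (𝟙 _) (by simp)
      rw [hz (f.1 ≫ χ) ⟨by rw [p.map_comp, hf', h₁]; simp, by simp [h₂]⟩, hz (𝟙 a) (by simp)]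
    have hχ : p.IsHomLift (𝟙 (p.obj a)) χ := IsHomLift.of_fac' p _ _ hb rfl (by simpa using h₁)
    exact ⟨⟨χ, hχ⟩, Subtype.ext h₃, Subtype.ext h₂⟩

/-- The category `𝒮 / U`, fibred over `𝒮`: the fibred category associated to the object `U`. -/
abbrev represented (U : 𝒮) : BasedCategory.{v₁, max u₁ v₁} 𝒮 :=
  BasedCategory.ofFunctor (Over.forget U)

instance (U : 𝒮) : IsFibredInGroupoids (represented U).p :=
  IsFibredInGroupoids.of_exists (Over.forget U)
    (fun b V f ↦ ⟨Over.mk (f ≫ b.hom), rfl, Over.homMk f rfl, (Category.id_comp f).symm⟩)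
    (fun a b c φ ψ g hg ↦ ⟨Over.homMk g (by
        have h₁ : φ.left ≫ b.hom = a.hom := Over.w φ
        have h₂ : ψ.left ≫ b.hom = c.hom := Over.w ψ
        have h₃ : (show c.left ⟶ a.left from g) ≫ φ.left = ψ.left := hg
        rw [← h₁, ← h₂, ← h₃]
        exact (Category.assoc _ _ _).symm), ⟨rfl, by ext; exact hg⟩,
      fun χ hχ ↦ by ext; exact hχ.1⟩)

variable (𝒮) in
/-- The category `𝒮`, fibred over itself. -/
abbrev base : BasedCategory.{v₁, u₁} 𝒮 := BasedCategory.ofFunctor (Functor.id 𝒮)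

instance : IsFibredInGroupoids (base 𝒮).p :=
  IsFibredInGroupoids.of_exists (Functor.id 𝒮)
    (fun _ V f ↦ ⟨V, rfl, f, (Category.id_comp f).symm⟩)
    (fun _ _ _ _ _ g hg ↦ ⟨g, ⟨rfl, hg⟩, fun _ hχ ↦ hχ.1⟩)

/-- The structure morphism of a category over `𝒮`. -/
abbrev structureMap (𝒯 : BasedCategory.{v₂, u₂} 𝒮) : 𝒯 ⥤ᵇ base 𝒮 where
  toFunctor := 𝒯.p
  w := rfl

/-- The morphism `𝒮 / U ⟶ 𝒮 / V` induced by `f : U ⟶ V`. -/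
abbrev representedMap {U V : 𝒮} (f : U ⟶ V) : represented U ⥤ᵇ represented V where
  toFunctor := Over.map f
  w := rfl

/-- A category over `𝒮` is representable if it is equivalent, over `𝒮`, to the category `𝒮 / U`
for some object `U` of `𝒮`. -/
class IsRepresentable (𝒯 : BasedCategory.{v₂, u₂} 𝒮) : Prop where
  exists_equivalence : ∃ (U : 𝒮) (f : 𝒯 ⥤ᵇ represented U) (g : represented U ⥤ᵇ 𝒯),
    Nonempty (f.comp g ≅ BasedFunctor.id 𝒯) ∧ Nonempty (g.comp f ≅ BasedFunctor.id (represented U))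

instance (U : 𝒮) : IsRepresentable (represented U) where
  exists_equivalence := ⟨U, BasedFunctor.id _, BasedFunctor.id _, ⟨Iso.refl _⟩, ⟨Iso.refl _⟩⟩

lemma hasTerminal_of_isRepresentable (𝒯 : BasedCategory.{v₂, u₂} 𝒮) [IsRepresentable 𝒯] :
    HasTerminal 𝒯.obj := by
  obtain ⟨U, f, g, ⟨e⟩, ⟨e'⟩⟩ := IsRepresentable.exists_equivalence (𝒯 := 𝒯)
  let E : 𝒯.obj ≌ Over U := CategoryTheory.Equivalence.mk f.toFunctor g.toFunctor
    ((BasedNatTrans.forgetful _ _).mapIso e).symm ((BasedNatTrans.forgetful _ _).mapIso e')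
  exact Adjunction.hasLimitsOfShape_of_equivalence E.functor

/-- Pull-back of a presheaf of groups from `𝒮` to a category `𝒯` over `𝒮`. -/
abbrev coeff (G : 𝒮ᵒᵖ ⥤ GrpCat.{w}) (𝒯 : BasedCategory.{v₂, u₂} 𝒮) : 𝒯.objᵒᵖ ⥤ GrpCat.{w} :=
  𝒯.p.op ⋙ G

/-- The identification of the pull-back along `f : 𝒯' ⟶ 𝒯` of the pull-back of `G` to `𝒯` with
the pull-back of `G` to `𝒯'`. -/
def coeffIso (G : 𝒮ᵒᵖ ⥤ GrpCat.{w}) {𝒯' : BasedCategory.{v₂, u₂} 𝒮}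
    {𝒯 : BasedCategory.{v₃, u₃} 𝒮} (f : 𝒯' ⥤ᵇ 𝒯) :
    f.toFunctor.op ⋙ coeff G 𝒯 ≅ coeff G 𝒯' :=
  Functor.isoWhiskerRight (NatIso.op (eqToIso f.w.symm)) G

section Site

variable (J : GrothendieckTopology 𝒮)
variable {𝒯' : BasedCategory.{v₂, u₂} 𝒮} {𝒯 : BasedCategory.{v₃, u₃} 𝒮}
  [IsFibredInGroupoids 𝒯'.p] [IsFibredInGroupoids 𝒯.p] (f : 𝒯' ⥤ᵇ 𝒯)

instance : f.toFunctor.IsContinuous (inheritedTopology J 𝒯'.p) (inheritedTopology J 𝒯.p) :=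
  isContinuous_inherited J _ _ _ f.w

instance : f.toFunctor.IsCocontinuous (inheritedTopology J 𝒯'.p) (inheritedTopology J 𝒯.p) :=
  isCocontinuous_inherited J _ _ _ f.w

lemma inheritedTopology_base : inheritedTopology J (base 𝒮).p = J := by
  ext U R
  rw [mem_inheritedTopology]
  exact iff_of_eq (congr_arg (· ∈ J U) (Sieve.functorPushforward_id (C := 𝒮) R))

variable (𝒯) in
instance : 𝒯.p.IsContinuous (inheritedTopology J 𝒯.p) J := by
  have h := isContinuous_inherited J 𝒯.p (base 𝒮).p 𝒯.p rfl
  rwa [inheritedTopology_base] at h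

variable (G : 𝒮ᵒᵖ ⥤ GrpCat.{w})

variable (𝒯) in
/-- The set of isomorphism classes of `G`-torsors over the fibred category `𝒯`, with its inherited
topology. -/
abbrev FibTorsorClasses : Type max u₃ v₃ (w + 1) :=
  TorsorClasses (inheritedTopology J 𝒯.p) (coeff G 𝒯)

/-- The pull-back of torsors along a morphism of fibred categories. -/
abbrev FibTorsorClasses.map : FibTorsorClasses J 𝒯 G → FibTorsorClasses J 𝒯' G :=
  TorsorClasses.map f.toFunctor (coeffIso G f)

variable (𝒯) in
/-- The first Čech cohomology of a fibred category `𝒯` (with its inherited topology) which has a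
final object: the Čech cohomology of a chosen final object. -/
abbrev FibCechH1 [HasTerminal 𝒯.obj] : Type max u₃ v₃ w (j + 1) :=
  CechH1.{j} (inheritedTopology J 𝒯.p) (coeff G 𝒯) (⊤_ 𝒯.obj)

/-- The pull-back in Čech cohomology along a morphism of fibred categories with final objects. -/
noncomputable abbrev FibCechH1.map [HasTerminal 𝒯.obj] [HasTerminal 𝒯'.obj] :
    FibCechH1.{j} J 𝒯 G → FibCechH1.{max j u₂ v₂ v₃} J 𝒯' G :=
  CechH1.map f.toFunctor (coeffIso G f) (terminal.from (f.toFunctor.obj (⊤_ 𝒯'.obj)))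

end Site

end FibredCategories

section Abelian

section

variable {C : Type u₁} [Category.{v₁} C] (J : GrothendieckTopology C)

variable (C) in
lemma essentiallySmall_of_univLE [UnivLE.{max u₁ v₁, w}] : EssentiallySmall.{w} C := by
  have : UnivLE.{u₁, w} := UnivLE.trans.{u₁, max u₁ v₁, w}
  have : UnivLE.{v₁, w} := UnivLE.trans.{v₁, max u₁ v₁, w}
  infer_instance

instance hasSheafify_ab [UnivLE.{max u₁ v₁, w}] : HasSheafify J AddCommGrpCat.{w} := by
  have := essentiallySmall_of_univLE.{v₁, u₁, w} C
  exact hasSheafifyEssentiallySmallSite J _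

instance hasExt_ab [UnivLE.{max u₁ v₁, w}] : HasExt.{w} (Sheaf J AddCommGrpCat.{w}) := by
  have := essentiallySmall_of_univLE.{v₁, u₁, w} C
  have := Sheaf.isGrothendieckAbelian_of_essentiallySmall J AddCommGrpCat.{w}
  exact IsGrothendieckAbelian.hasExt _

variable {D : Type u₂} [Category.{v₂} D] (K : GrothendieckTopology D) (F : D ⥤ C)

instance additive_pullback [UnivLE.{max u₁ v₁, w}] [UnivLE.{max u₂ v₂, w}] [F.IsContinuous K J] :
    (F.sheafPushforwardContinuous AddCommGrpCat.{w} K J).Additive where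

instance preservesFiniteLimits_pullback [F.IsContinuous K J] :
    PreservesFiniteLimits (F.sheafPushforwardContinuous AddCommGrpCat.{w} K J) where
  preservesFiniteLimits I _ _ := by
    have : PreservesLimitsOfShape I
        (F.sheafPushforwardContinuous AddCommGrpCat.{w} K J ⋙ sheafToPresheaf K _) :=
      inferInstanceAs (PreservesLimitsOfShape I
        (sheafToPresheaf J _ ⋙ (Functor.whiskeringLeft _ _ _).obj F.op))
    exact preservesLimitsOfShape_of_reflects_of_preserves _ (sheafToPresheaf K _)

instance preservesFiniteColimits_pullback [UnivLE.{max u₁ v₁, w}] [UnivLE.{max u₂ v₂, w}]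
    [F.IsContinuous K J] [F.IsCocontinuous K J] :
    PreservesFiniteColimits (F.sheafPushforwardContinuous AddCommGrpCat.{w} K J) := by
  have := essentiallySmall_of_univLE.{v₁, u₁, w} C
  have := essentiallySmall_of_univLE.{v₂, u₂, w} D
  have (X : Cᵒᵖ) : HasLimitsOfShape (StructuredArrow X F.op) AddCommGrpCat.{w} :=
    hasLimitsOfShape_of_equivalence (equivSmallModel.{w} (StructuredArrow X F.op)).symm
  have (P : Dᵒᵖ ⥤ AddCommGrpCat.{w}) : F.op.HasPointwiseRightKanExtension P :=
    inferInstance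
  have := (F.sheafAdjunctionCocontinuous AddCommGrpCat.{w} K J).leftAdjoint_preservesColimits
  infer_instance

end

noncomputable section

variable {C : Type u₁} [Category.{v₁} C] (J : GrothendieckTopology C) [UnivLE.{max u₁ v₁, w}]

/-- The constant sheaf `ℤ` on the site `(C, J)`. -/
abbrev constZ : Sheaf J AddCommGrpCat.{w} :=
  (constantSheaf J AddCommGrpCat.{w}).obj (AddCommGrpCat.of (ULift.{w} ℤ))

variable {D : Type u₂} [Category.{v₂} D] [UnivLE.{max u₂ v₂, w}] (K : GrothendieckTopology D)
  (F : D ⥤ C) [F.IsContinuous K J]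

/-- The canonical morphism `ℤ ⟶ F^* ℤ` (an isomorphism if `F` is cocontinuous), corresponding to the
restriction along `F` of the canonical morphism from the constant presheaf to the
constant sheaf. -/
def constZHom : constZ.{v₂, u₂, w} K ⟶
    (F.sheafPushforwardContinuous AddCommGrpCat.{w} K J).obj (constZ J) :=
  ((sheafificationAdjunction K AddCommGrpCat.{w}).homEquiv _ _).symm
    (Functor.whiskerLeft F.op
      (toSheafify J ((Functor.const Cᵒᵖ).obj (AddCommGrpCat.of (ULift.{w} ℤ)))))

variable {J K} [F.IsCocontinuous K J]

/-- The pull-back map `Hⁿ(C, G) ⟶ Hⁿ(D, G')` in derived functor cohomology along a continuous and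
cocontinuous functor `F`, the pulled back sheaf `F^* G` being identified with `G'`. It sends a
morphism `ℤ ⟶ G[n]` of the derived category to the composition `ℤ ⟶ F^* ℤ ⟶ F^* G[n] ⟶ G'[n]`. -/
def derivedMap (n : ℕ) {G : Sheaf J AddCommGrpCat.{w}} {G' : Sheaf K AddCommGrpCat.{w}}
    (φ : (F.sheafPushforwardContinuous AddCommGrpCat.{w} K J).obj G ⟶ G') (x : G.H n) : G'.H n :=
  ((Abelian.Ext.mk₀ (constZHom J K F)).comp
    (x.mapExactFunctor (F.sheafPushforwardContinuous AddCommGrpCat.{w} K J))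
    (zero_add n)).comp (Abelian.Ext.mk₀ φ) (add_zero n)

end

end Abelian

noncomputable section

variable {𝒮 : Type u₁} [Category.{v₁} 𝒮] (J : GrothendieckTopology 𝒮)
variable {𝒯' : BasedCategory.{v₂, u₂} 𝒮} {𝒯 : BasedCategory.{v₃, u₃} 𝒮}
  [IsFibredInGroupoids 𝒯'.p] [IsFibredInGroupoids 𝒯.p] (f : 𝒯' ⥤ᵇ 𝒯)
  (G : Sheaf J AddCommGrpCat.{w})

variable (𝒯) in
/-- Pull-back of a sheaf of abelian groups from `𝒮` to a fibred category `𝒯`. -/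
abbrev coeffAb : Sheaf (inheritedTopology J 𝒯.p) AddCommGrpCat.{w} :=
  (𝒯.p.sheafPushforwardContinuous AddCommGrpCat.{w} (inheritedTopology J 𝒯.p) J).obj G

/-- The identification of the pull-back along `f : 𝒯' ⟶ 𝒯` of the pull-back of `G` to `𝒯` with
the pull-back of `G` to `𝒯'`. -/
def coeffAbIso :
    (f.toFunctor.sheafPushforwardContinuous AddCommGrpCat.{w} (inheritedTopology J 𝒯'.p)
      (inheritedTopology J 𝒯.p)).obj (coeffAb J 𝒯 G) ≅ coeffAb J 𝒯' G :=
  (fullyFaithfulSheafToPresheaf _ _).preimageIso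
    (Functor.isoWhiskerRight (NatIso.op (eqToIso f.w.symm)) G.obj)

variable (𝒯) in
/-- The derived functor cohomology `Hⁿ(𝒯, G)` of a fibred category `𝒯` (with its inherited
topology) with coefficients in the pull-back of a sheaf of abelian groups `G` on `𝒮`. -/
abbrev FibH [UnivLE.{max u₃ v₃, w}] (n : ℕ) : Type w := (coeffAb J 𝒯 G).H n

/-- The pull-back in derived functor cohomology along a morphism of fibred categories. -/
abbrev FibH.map [UnivLE.{max u₃ v₃, w}] [UnivLE.{max u₂ v₂, w}] (n : ℕ) :
    FibH J 𝒯 G n → FibH J 𝒯' G n :=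
  derivedMap f.toFunctor n (coeffAbIso J f G).hom

/-- The sheaf of groups underlying a sheaf of abelian groups, as a presheaf. -/
abbrev groupOfAb : 𝒮ᵒᵖ ⥤ GrpCat.{w} :=
  G.obj ⋙ AddCommGrpCat.toCommGrp ⋙ forget₂ CommGrpCat GrpCat

end


section Obstruction

variable {𝒮 : Type u} [Category.{v₃} 𝒮]

/-- The full subcategory of `𝒳(𝒜)`, the category of morphisms `𝒜 ⟶ 𝒳` over `𝒮`, cut out by the
obstruction given by a contravariant functor `Φ`: it consists of those `x : 𝒜 ⟶ 𝒳` such that for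
all `A ∈ Φ(𝒳)`, the pull-back `A(x) = Φ(x)(A)` is in the image of `Φ(q) : Φ(𝒮) ⟶ Φ(𝒜)`,
with `q` the structure morphism of `𝒜`. The functor enters through its values `FX`, `FA`, `FS` at
`𝒳`, `𝒜` and `𝒮`, the maps `ev x = Φ(x)` and the map `Φ(q)`. -/
def obstruction {𝒳 : BasedCategory.{v₁, u₁} 𝒮} {𝒜 : BasedCategory.{v₂, u₂} 𝒮}
    {FX FA FS : Type*} (ev : (𝒜 ⥤ᵇ 𝒳) → FX → FA) (q : FS → FA) : ObjectProperty (𝒜 ⥤ᵇ 𝒳) :=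
  fun x ↦ ∀ A : FX, ev x A ∈ Set.range q

end Obstruction

section Schemes

/-- The two topologies on schemes: étale and fppf. -/
inductive Topo
  | etale
  | fppf

/-- The big étale or fppf topology on the category of `S`-schemes. -/
def Topo.big (τ : Topo) (S : Scheme.{u}) : GrothendieckTopology (Over S) :=
  match τ with
  | etale => Scheme.etaleTopology.over S
  | fppf => Scheme.fppfTopology.over S

variable (τ : Topo) {S : Scheme.{u}}
  (𝒳 : BasedCategory.{v₁, u₁} (Over S)) (𝒜 : BasedCategory.{v₂, u₂} (Over S))
  [IsFibredInGroupoids 𝒳.p] [IsFibredInGroupoids 𝒜.p]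

/-- The obstruction given by isomorphism classes of torsors under a group `G`. -/
def torsorObstruction (G : (Over S)ᵒᵖ ⥤ GrpCat.{w}) : ObjectProperty (𝒜 ⥤ᵇ 𝒳) :=
  obstruction (fun x ↦ FibTorsorClasses.map (τ.big S) x G)
    (FibTorsorClasses.map (τ.big S) (structureMap 𝒜) G)

instance (S : Scheme.{u}) : HasTerminal (base (Over S)).obj :=
  inferInstanceAs (HasTerminal (Over S))

/-- The obstruction given by the first Čech cohomology with coefficients in a group `G`, for
representable fibred categories. The universe of the index sets of the coverings is
chosen large enough to allow the coverings given by all sieves. -/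
def cechObstruction [IsRepresentable 𝒳] [IsRepresentable 𝒜] (G : (Over S)ᵒᵖ ⥤ GrpCat.{w}) :
    ObjectProperty (𝒜 ⥤ᵇ 𝒳) :=
  haveI := hasTerminal_of_isRepresentable 𝒳
  haveI := hasTerminal_of_isRepresentable 𝒜
  obstruction (fun x ↦ FibCechH1.map.{max (u + 1) u₁ v₁ u₂ v₂} (τ.big S) x G)
    (FibCechH1.map.{max (u + 1) u₁ v₁ u₂ v₂} (τ.big S) (structureMap 𝒜) G)

/-- The obstruction given by the derived functor cohomology `H¹` with coefficients in a sheaf of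
abelian groups `G`. -/
def derivedObstruction [UnivLE.{max u₁ v₁, w}] [UnivLE.{max u₂ v₂, w}] [UnivLE.{u + 1, w}]
    (G : Sheaf (τ.big S) AddCommGrpCat.{w}) : ObjectProperty (𝒜 ⥤ᵇ 𝒳) :=
  obstruction (fun x ↦ FibH.map (τ.big S) x G 1) (FibH.map (τ.big S) (structureMap 𝒜) G 1)

end Schemes

section NumberField

open NumberField

variable (k : Type u) [Field k] [NumberField k]

/-- The spectrum of the ring of adeles of the number field `k`, as a `k`-scheme. -/
noncomputable abbrev adeles : Over (Spec (.of k)) :=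
  Over.mk (Spec.map (CommRingCat.ofHom (algebraMap k (AdeleRing (𝓞 k) k))))

variable (X : Over (Spec (.of k)))

/-- The descent set in `X(𝔸ₖ)`: the adelic points which are in the obstruction category of
`G`-torsors for all sheaves of groups `G` on the big fppf site of `k`. -/
def descSet : Set (adeles k ⟶ X) :=
  {x | ∀ G : Sheaf (Topo.fppf.big (Spec (.of k))) GrpCat.{u + 1},
    torsorObstruction .fppf (represented X) (represented (adeles k)) G.obj (representedMap x)}

/-- The classical descent set in `X(𝔸ₖ)`: the adelic points which are in the obstruction category
of the fppf Čech cohomology with coefficients in `G` for all affine group schemes `G` over `k`. -/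
def classicalDescSet : Set (adeles k ⟶ X) :=
  {x | ∀ (G : Over (Spec (.of k))) [GrpObj G], IsAffine G.left →
    cechObstruction .fppf (represented X) (represented (adeles k)) (yonedaGrpObj G)
      (representedMap x)}

end NumberField

end FibObs

-- An obstruction sees a functor only through its values at `𝒳`, `𝒜` and `𝒮` and through the
-- pull-backs along `x : 𝒜 ⟶ 𝒳` and `q`. By `obstruction_eq`, comparison maps compatible with
-- pull-back that are surjective at `𝒳` and `𝒮` and injective at `𝒜` therefore identify two
-- obstructions. Both equalities thus reduce to a classification of torsors that is natural in the
-- site.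
--
-- Čech cohomology. Over a site with a final object, sections of a torsor over a covering differ by
-- a cocycle, and twisting the sheaf `G` by a cocycle gives back a torsor. The relation `HasCocycle`
-- between torsors and cocycles organises this: every torsor has a cocycle (`exists_hasCocycle`),
-- every cocycle belongs to its twist (`torsor_hasCocycle`), a cocycle determines the torsor up to
-- isomorphism (`isIsomorphic_torsor`), a torsor determines the cocycle up to refinement and
-- coboundary (`HasCocycle.cechRel`), and the relation is stable under pull-back
-- (`HasCocycle.pullback`). The inclusion of descent sets follows, since a group scheme represents
-- an fppf sheaf of groups; only a change of universe remains, and Čech cohomology is insensitive to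
-- it.
--
-- Derived functor cohomology. Embed `A` into an injective sheaf `I`. Every `A`-torsor `P` maps
-- equivariantly to `I`: constants embed `A` into the sheaf of functions `P ⟶ A`, a section `p` of
-- `P` gives the function `p' ↦ p - p'`, and `A ⟶ I` extends from the constants to all functions
-- (`exists_equivariantMap`). So `P` is the fibre of `I ⟶ I/A` over a global section, whose image
-- under the connecting map is the class of `P`. Two global sections have the same image exactly
-- when they differ by one that lifts to `I`, that is, when their fibres are translates of each
-- other; and all classes occur because `Ext¹(ℤ, I) = 0`. For naturality, `F^* I` need not be
-- injective, but `F^*` is exact and `F^* A ⟶ A'` extends to the chosen injective sequence of `A'`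
-- (`HasClass.pullback`).
--
-- The `UnivLE` hypotheses allow the twists and the function sheaves, built as families indexed by
-- the whole site, to be shrunk to the universe of the coefficients.

universe w' s

namespace FibObs

/-! ### Glueing, and the sheaf condition on underlying sets -/

section Glueing

variable {C : Type u₁} [Category.{v₁} C] {J : GrothendieckTopology C} {F : Cᵒᵖ ⥤ Type w}

/-- In a sheaf, locally unique and locally existing sections glue. -/
lemma exists_glue (hF : Presieve.IsSheaf J F) {V : C}
    (r : ∀ ⦃W : C⦄, (W ⟶ V) → F.obj (op W) → Prop)
    (stable : ∀ ⦃W W' : C⦄ (g : W' ⟶ W) (f : W ⟶ V) (x : F.obj (op W)),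
      r f x → r (g ≫ f) (F.map g.op x))
    (unique : ∀ ⦃W : C⦄ (f : W ⟶ V) (x y : F.obj (op W)), r f x → r f y → x = y)
    (R : Sieve V) (hR : R ∈ J V) (ex : ∀ ⦃W : C⦄ (f : W ⟶ V), R f → ∃ x, r f x) :
    ∃ x : F.obj (op V), ∀ ⦃W : C⦄ (f : W ⟶ V) (y : F.obj (op W)), r f y → F.map f.op x = y := by
  let S : Sieve V :=
    { arrows := fun W f ↦ ∃ x, r f x
      downward_closed := by
        rintro W W' f ⟨x, hx⟩ g
        exact ⟨_, stable g f x hx⟩ }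
  have hS : S ∈ J V := J.superset_covering (fun W f hf ↦ ex f hf) hR
  let x : Presieve.FamilyOfElements F S.arrows := fun W f hf ↦ hf.choose
  have hx : ∀ ⦃W : C⦄ (f : W ⟶ V) (hf : S f), r f (x f hf) := fun W f hf ↦ hf.choose_spec
  have hc : x.Compatible := by
    intro W₁ W₂ Z g₁ g₂ f₁ f₂ h₁ h₂ h
    refine unique (g₁ ≫ f₁) _ _ (stable g₁ f₁ _ (hx f₁ h₁)) ?_
    rw [h]
    exact stable g₂ f₂ _ (hx f₂ h₂)
  obtain ⟨y, hy, -⟩ := hF S hS x hc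
  refine ⟨y, fun W f z hz ↦ ?_⟩
  rw [hy f ⟨z, hz⟩]
  exact unique f _ _ (hx f _) hz

lemma ext_of_mem (hF : Presieve.IsSheaf J F) {V : C} {R : Sieve V} (hR : R ∈ J V)
    {x y : F.obj (op V)} (h : ∀ ⦃W : C⦄ (f : W ⟶ V), R f → F.map f.op x = F.map f.op y) : x = y :=
  (hF R hR).isSeparatedFor.ext h

/-- A natural family of equivalences transports the sheaf condition, in any universes. -/
lemma isSheaf_of_equiv {F' : Cᵒᵖ ⥤ Type s} (hF : Presieve.IsSheaf J F)
    (e : ∀ X : C, F.obj (op X) ≃ F'.obj (op X))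
    (he : ∀ ⦃X Y : C⦄ (f : X ⟶ Y) (x : F.obj (op Y)), e X (F.map f.op x) = F'.map f.op (e Y x)) :
    Presieve.IsSheaf J F' :=
  (Presieve.isSheaf_iff_of_nat_equiv (fun X ↦ e X) (fun _ _ f x ↦ he f x)).1 hF

lemma sheaf_isSheaf (F : Sheaf J (Type w)) : Presieve.IsSheaf J F.obj :=
  (isSheaf_iff_isSheaf_of_type J _).1 F.property

/-- `ℤ` corepresents the forgetful functor, so the sheaf condition tested on morphisms out of `ℤ` is
the one for the underlying sets. -/
lemma isSheaf_forget_grp {G : Cᵒᵖ ⥤ GrpCat.{w}} (hG : Presheaf.IsSheaf J G) :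
    Presieve.IsSheaf J (G ⋙ forget GrpCat.{w}) :=
  isSheaf_of_equiv (hG (GrpCat.of (ULift.{w} (Multiplicative ℤ))))
    (fun X ↦ (GrpCat.coyonedaObjIsoForget.app (G.obj (op X))).toEquiv)
    (fun _ _ _ _ ↦ rfl)

lemma isSheaf_forget_ab {G : Cᵒᵖ ⥤ AddCommGrpCat.{w}} (hG : Presheaf.IsSheaf J G) :
    Presieve.IsSheaf J (G ⋙ forget AddCommGrpCat.{w}) :=
  isSheaf_of_equiv (hG (AddCommGrpCat.of (ULift.{w} ℤ)))
    (fun X ↦ (AddCommGrpCat.coyonedaObjIsoForget.app (G.obj (op X))).toEquiv)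
    (fun _ _ _ _ ↦ rfl)

/-- A compatible family of morphisms out of `E` is glued element by element; additivity and
uniqueness of the result hold locally, hence globally by separatedness. -/
lemma isSheaf_ab_of_forget {G : Cᵒᵖ ⥤ AddCommGrpCat.{w}}
    (hG : Presieve.IsSheaf J (G ⋙ forget AddCommGrpCat.{w})) : Presheaf.IsSheaf J G := by
  intro E V R hR x hx
  let x' ⦃W : C⦄ (f : W ⟶ V) (hf : R f) : E ⟶ G.obj (op W) := x f hf
  have key (e : E) : ∃ y : G.obj (op V), ∀ ⦃W : C⦄ (f : W ⟶ V) (hf : R f),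
      G.map f.op y = x' f hf e := by
    obtain ⟨y, hy, -⟩ := hG R hR (fun W f hf ↦ x' f hf e) (by
      intro W₁ W₂ Z g₁ g₂ f₁ f₂ h₁ h₂ h
      exact ConcreteCategory.congr_hom (hx g₁ g₂ h₁ h₂ h) e)
    exact ⟨y, hy⟩
  choose y hy using key
  have hext {a b : G.obj (op V)} (h : ∀ ⦃W : C⦄ (f : W ⟶ V), R f → G.map f.op a = G.map f.op b) :
      a = b := ext_of_mem (F := G ⋙ forget _) hG hR h
  refine ⟨AddCommGrpCat.ofHom (AddMonoidHom.mk' y fun a b ↦ hext fun W f hf ↦ ?_), ?_, ?_⟩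
  · rw [hy _ f hf, map_add, map_add, hy _ f hf, hy _ f hf]
  · intro W f hf
    change AddCommGrpCat.ofHom _ ≫ G.map f.op = x' f hf
    ext e
    exact hy e f hf
  · intro z hz
    change (show E ⟶ G.obj (op V) from z) = _
    ext e
    refine hext fun W f hf ↦ ?_
    exact (ConcreteCategory.congr_hom (hz f hf) e).trans (hy e f hf).symm

end Glueing

/-! ### Differences of sections and morphisms of torsors -/

namespace Torsor

variable {C : Type u₁} [Category.{v₁} C] {J : GrothendieckTopology C} {G : Cᵒᵖ ⥤ GrpCat.{w}}

lemma map_comp (P : Torsor J G) {U V W : C} (f : W ⟶ V) (g : V ⟶ U) (y : P.sheaf.obj.obj (op U)) :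
    P.sheaf.obj.map (f ≫ g).op y = P.sheaf.obj.map f.op (P.sheaf.obj.map g.op y) := by
  rw [op_comp, P.sheaf.obj.map_comp]; rfl

lemma exists_act_eq (P : Torsor J G) {U : C} (y z : P.sheaf.obj.obj (op U)) :
    ∃ g, P.act y g = z := by
  obtain ⟨⟨a, g⟩, h⟩ := (P.bijective U).2 (y, z)
  obtain ⟨rfl, rfl⟩ := Prod.ext_iff.1 h
  exact ⟨g, rfl⟩

lemma act_injective (P : Torsor J G) {U : C} (y : P.sheaf.obj.obj (op U)) {g h : G.obj (op U)}
    (e : P.act y g = P.act y h) : g = h :=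
  (Prod.ext_iff.1 ((P.bijective U).1 (a₁ := (y, g)) (a₂ := (y, h)) (Prod.ext rfl e))).2

/-- The element of `G` by which two sections of a torsor differ. -/
noncomputable def diff (P : Torsor J G) {U : C} (y z : P.sheaf.obj.obj (op U)) : G.obj (op U) :=
  (P.exists_act_eq y z).choose

@[simp] lemma act_diff (P : Torsor J G) {U : C} (y z : P.sheaf.obj.obj (op U)) :
    P.act y (P.diff y z) = z := (P.exists_act_eq y z).choose_spec

lemma diff_eq (P : Torsor J G) {U : C} {y z : P.sheaf.obj.obj (op U)} {g : G.obj (op U)}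
    (h : P.act y g = z) : P.diff y z = g :=
  P.act_injective y ((P.act_diff y z).trans h.symm)

lemma map_diff (P : Torsor J G) {U V : C} (f : V ⟶ U) (y z : P.sheaf.obj.obj (op U)) :
    G.map f.op (P.diff y z) = P.diff (P.sheaf.obj.map f.op y) (P.sheaf.obj.map f.op z) := by
  refine (P.diff_eq ?_).symm
  rw [← P.map_act, P.act_diff]

lemma diff_mul_diff (P : Torsor J G) {U : C} (x y z : P.sheaf.obj.obj (op U)) :
    P.diff x y * P.diff y z = P.diff x z :=
  (P.diff_eq (by rw [P.act_mul, P.act_diff, P.act_diff])).symm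

lemma diff_act (P : Torsor J G) {U : C} (x y : P.sheaf.obj.obj (op U)) (g : G.obj (op U)) :
    P.diff x (P.act y g) = P.diff x y * g :=
  P.diff_eq (by rw [P.act_mul, P.act_diff])

/-- An equivariant morphism of torsors is an isomorphism. -/
lemma isIsomorphic_of_hom (P Q : Torsor J G)
    (φ : ∀ U : C, P.sheaf.obj.obj (op U) → Q.sheaf.obj.obj (op U))
    (hφ : ∀ ⦃U V : C⦄ (f : V ⟶ U) (y : P.sheaf.obj.obj (op U)),
      φ V (P.sheaf.obj.map f.op y) = Q.sheaf.obj.map f.op (φ U y))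
    (hφ' : ∀ (U : C) (y : P.sheaf.obj.obj (op U)) (g : G.obj (op U)),
      φ U (P.act y g) = Q.act (φ U y) g) : P.IsIsomorphic Q := by
  have inj (U : C) : Function.Injective (φ U) := by
    intro y z h
    rw [← P.act_diff y z, hφ'] at h
    have h1 : (1 : G.obj (op U)) = P.diff y z := Q.act_injective (φ U y) (by rw [Q.act_one, ← h])
    rw [← P.act_diff y z, ← h1, P.act_one]
  -- Where `P` has a section, its image can be moved to `q` by the action; injectivity makes these
  -- local preimages unique, so they glue.
  have surj (U : C) : Function.Surjective (φ U) := by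
    intro q
    obtain ⟨R, hR, hn⟩ := P.locally_nonempty U
    have loc : ∀ ⦃W : C⦄ (f : W ⟶ U), R f → ∃ p, φ W p = Q.sheaf.obj.map f.op q := by
      intro W f hf
      obtain ⟨p⟩ := hn f hf
      exact ⟨P.act p (Q.diff (φ W p) (Q.sheaf.obj.map f.op q)), by rw [hφ', Q.act_diff]⟩
    obtain ⟨p, hp⟩ := exists_glue (sheaf_isSheaf P.sheaf)
      (fun W f p ↦ φ W p = Q.sheaf.obj.map f.op q)
      (fun W W' g f x hx ↦ by rw [hφ, hx, Q.map_comp])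
      (fun W f x y hx hy ↦ inj W (hx.trans hy.symm)) R hR loc
    refine ⟨p, ext_of_mem (sheaf_isSheaf Q.sheaf) hR fun W f hf ↦ ?_⟩
    obtain ⟨y, hy⟩ := loc f hf
    rw [← hφ, hp f y hy, hy]
  let e : P.sheaf.obj ≅ Q.sheaf.obj := NatIso.ofComponents
    (fun U ↦ (Equiv.ofBijective (φ U.unop) ⟨inj _, surj _⟩).toIso)
    (fun {U V} f ↦ by
      ext y
      exact hφ f.unop y)
  exact ⟨(fullyFaithfulSheafToPresheaf _ _).preimageIso e, fun U y g ↦ hφ' U y g⟩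

end Torsor

/-! ### Sheaves of local morphisms subject to a local condition -/

section HomFamilies

variable {C : Type u₁} [Category.{v₁} C] {J : GrothendieckTopology C}
  (B : Cᵒᵖ ⥤ Type s) (F : Cᵒᵖ ⥤ Type w) (p : ∀ ⦃W : C⦄, (B.obj (op W) → F.obj (op W)) → Prop)

/-- Morphisms of presheaves from the restriction of `B` to `C / V` to the restriction of `F`, all
of whose components satisfy `p`. -/
@[ext]
structure HomFamily (V : C) where
  val ⦃W : C⦄ (f : W ⟶ V) (b : B.obj (op W)) : F.obj (op W)
  map_val ⦃W W' : C⦄ (g : W' ⟶ W) (f : W ⟶ V) (b : B.obj (op W)) :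
    F.map g.op (val f b) = val (g ≫ f) (B.map g.op b)
  prop ⦃W : C⦄ (f : W ⟶ V) : p (val f)

variable {B F p}

/-- Restriction of a family. -/
@[simps]
def HomFamily.restrict {V V' : C} (h : V' ⟶ V) (y : HomFamily B F p V) : HomFamily B F p V' where
  val W f b := y.val (f ≫ h) b
  map_val W W' g f b := by rw [y.map_val, Category.assoc]
  prop W f := y.prop _

variable (B F p) in
/-- The presheaf of families `HomFamily B F p`. -/
@[simps]
def homFamilies : Cᵒᵖ ⥤ Type (max u₁ v₁ s w) where
  obj V := HomFamily B F p V.unop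
  map h := TypeCat.ofHom (HomFamily.restrict h.unop)
  map_id V := by
    ext y
    simp
  map_comp g h := by
    ext y
    simp

/-- Only the target has to be a sheaf: each value of the glued family is itself glued in `F`, and
`hp` says that the condition `p` is local. This is used for twists by a cocycle, where `B` is the
disjoint union of a covering, and for the functions on a torsor, where `p` is empty. -/
lemma homFamilies_isSheaf (hF : Presieve.IsSheaf J F)
    (hp : ∀ ⦃W : C⦄ (R : Sieve W), R ∈ J W →
      ∀ y : ∀ ⦃W' : C⦄ (_ : W' ⟶ W) (_ : B.obj (op W')), F.obj (op W'),
      (∀ ⦃W' : C⦄ (g : W' ⟶ W) (b : B.obj (op W)),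
        F.map g.op (y (𝟙 W) b) = y g (B.map g.op b)) →
      (∀ ⦃W' : C⦄ (g : W' ⟶ W), R g → p (y g)) → p (y (𝟙 W))) :
    Presieve.IsSheaf J (homFamilies B F p) := by
  intro V R hR x hx
  let x' ⦃W : C⦄ (f : W ⟶ V) (hf : R f) : HomFamily B F p W := x f hf
  have hx' ⦃W W' : C⦄ (f : W ⟶ V) (hf : R f) (g : W' ⟶ W) ⦃Z : C⦄ (k : Z ⟶ W')
      (b : B.obj (op Z)) :
      (x' (g ≫ f) (R.downward_closed hf g)).val k b = (x' f hf).val (k ≫ g) b := by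
    have h := hx (𝟙 W') g (R.downward_closed hf g) hf (by simp)
    have h₁ := congr_arg (fun z : HomFamily B F p W' ↦ z.val k b) h
    change (x' (g ≫ f) _).val (k ≫ 𝟙 W') b = _ at h₁
    rw [Category.comp_id] at h₁
    exact h₁
  -- After a further restriction `g` with `g ≫ f` in `R`, the value is prescribed by the given
  -- family at the identity; these prescriptions cover `W`.
  have key ⦃W : C⦄ (f : W ⟶ V) (b : B.obj (op W)) : ∃ z : F.obj (op W), ∀ ⦃Z : C⦄ (g : Z ⟶ W)
      (hg : R (g ≫ f)), F.map g.op z = (x' (g ≫ f) hg).val (𝟙 Z) (B.map g.op b) := by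
    obtain ⟨z, hz⟩ := exists_glue hF (V := W)
      (fun Z g z ↦ ∃ hg : R (g ≫ f), z = (x' (g ≫ f) hg).val (𝟙 Z) (B.map g.op b))
      (by
        rintro Z Z' k g z ⟨hg, rfl⟩
        refine ⟨by rw [Category.assoc]; exact R.downward_closed hg k, ?_⟩
        rw [HomFamily.map_val]
        have := hx' (g ≫ f) hg k (𝟙 Z') (B.map (k ≫ g).op b)
        simp only [Category.assoc] at this ⊢
        rw [this]
        simp)
      (by
        rintro Z g _ _ ⟨h, rfl⟩ ⟨h', rfl⟩
        rfl)
      (R.pullback f) (J.pullback_stable f hR) (fun Z g hg ↦ ⟨_, hg, rfl⟩)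
    exact ⟨z, fun Z g hg ↦ hz g _ ⟨hg, rfl⟩⟩
  choose y hy using key
  have hy' ⦃W : C⦄ (f : W ⟶ V) (hf : R f) (b : B.obj (op W)) :
      y f b = (x' f hf).val (𝟙 W) b := by
    have h := hy f b (𝟙 W) (by simpa using hf)
    have e := hx' f hf (𝟙 W) (𝟙 W) b
    simp only [op_id, Functor.map_id_apply] at h
    rw [h, e]
    simp
  have nat ⦃W W' : C⦄ (g : W' ⟶ W) (f : W ⟶ V) (b : B.obj (op W)) :
      F.map g.op (y f b) = y (g ≫ f) (B.map g.op b) := by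
    refine ext_of_mem hF (J.pullback_stable (g ≫ f) hR) fun Z k hk ↦ ?_
    rw [hy (g ≫ f) _ k hk, ← Functor.map_comp_apply, ← op_comp,
      hy f b (k ≫ g) (by simpa using! hk)]
    simp
  have prop ⦃W : C⦄ (f : W ⟶ V) : p (y f) := by
    have h := hp (R.pullback f) (J.pullback_stable f hR) (fun W' g ↦ y (g ≫ f))
      (fun W' g b ↦ by simpa using nat g f b) (fun W' g hg ↦ by
        have h := (x' (g ≫ f) hg).prop (𝟙 _)
        convert h using 1
        funext b
        exact hy' _ hg b)
    simpa using h
  refine ⟨⟨y, nat, prop⟩, ?_, ?_⟩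
  · intro W f hf
    refine HomFamily.ext ?_
    funext Z k b
    change y (k ≫ f) b = (x' f hf).val k b
    rw [hy' _ (R.downward_closed hf k), hx' f hf, Category.id_comp]
  · intro z hz
    refine HomFamily.ext ?_
    funext W f b
    change (show HomFamily B F p V from z).val f b = y f b
    refine ext_of_mem hF (J.pullback_stable f hR) fun Z k hk ↦ ?_
    rw [hy f b k hk, HomFamily.map_val]
    have h := congr_arg (fun z : HomFamily B F p Z ↦ z.val (𝟙 Z) (B.map k.op b)) (hz (k ≫ f) hk)
    change (show HomFamily B F p V from z).val (𝟙 Z ≫ k ≫ f) _ = _ at h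
    rw [Category.id_comp] at h
    exact h

end HomFamilies

/-! ### Torsors and their Čech cocycles -/

section CechTorsor

variable {C : Type u₁} [Category.{v₁} C] {J : GrothendieckTopology C} {G : Cᵒᵖ ⥤ GrpCat.{w}}
  {T : C} (hT : IsTerminal T)

namespace Covering.Cocycle

variable {𝒰 : Covering.{j} J T} (c : 𝒰.Cocycle G)

/-- The values of a Čech cocycle of a final object. -/
def eval (i k : 𝒰.I) {W : C} (a : W ⟶ 𝒰.X i) (b : W ⟶ 𝒰.X k) : G.obj (op W) :=
  c.ev i k (T := Over.mk (hT.from W)) (Over.homMk a (hT.hom_ext _ _))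
    (Over.homMk b (hT.hom_ext _ _))

lemma map_eval (i k : 𝒰.I) {W W' : C} (f : W' ⟶ W) (a : W ⟶ 𝒰.X i) (b : W ⟶ 𝒰.X k) :
    G.map f.op (c.eval hT i k a b) = c.eval hT i k (f ≫ a) (f ≫ b) :=
  c.ev_precomp i k (Over.homMk f (hT.hom_ext _ _) :
    Over.mk (hT.from W') ⟶ Over.mk (hT.from W)) _ _

/-- As `T` is final, the structure arrow of an object over `T` carries no information, and the
identity of its source is an arrow to the standard object over `T`. -/
lemma ev_eq_eval (i k : 𝒰.I) {W : Over T} (a : W ⟶ Over.mk (𝒰.π i)) (b : W ⟶ Over.mk (𝒰.π k)) :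
    c.ev i k a b = c.eval hT i k a.left b.left := by
  let φ : W ⟶ Over.mk (hT.from W.left) := Over.homMk (𝟙 _) (hT.hom_ext _ _)
  have h := c.ev_precomp i k φ (Over.homMk a.left (hT.hom_ext _ _))
    (Over.homMk b.left (hT.hom_ext _ _))
  have ha : φ ≫ Over.homMk a.left (hT.hom_ext _ _) = a := by ext; simp [φ]
  have hb : φ ≫ Over.homMk b.left (hT.hom_ext _ _) = b := by ext; simp [φ]
  rw [ha, hb] at h
  rw [← h]
  exact ConcreteCategory.congr_hom (G.map_id _) _

lemma eval_mul_eval (i k l : 𝒰.I) {W : C} (a : W ⟶ 𝒰.X i) (b : W ⟶ 𝒰.X k) (d : W ⟶ 𝒰.X l) :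
    c.eval hT i k a b * c.eval hT k l b d = c.eval hT i l a d :=
  c.ev_trans _ _ _ _ _ _

end Covering.Cocycle

namespace Torsor

/-- The torsor `P` has sections over the members of the covering whose differences are given
by the cocycle. -/
def HasCocycle (P : Torsor J G) (x : Σ 𝒰 : Covering.{j} J T, 𝒰.Cocycle G) : Prop :=
  ∃ y : ∀ i, P.sheaf.obj.obj (op (x.1.X i)), ∀ (i k : x.1.I) ⦃W : C⦄ (a : W ⟶ x.1.X i)
    (b : W ⟶ x.1.X k), P.sheaf.obj.map b.op (y k) =
      P.act (P.sheaf.obj.map a.op (y i)) (x.2.eval hT i k a b)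

variable {hT}

lemma HasCocycle.of_isIsomorphic {P Q : Torsor J G} {x : Σ 𝒰 : Covering.{j} J T, 𝒰.Cocycle G}
    (h : P.HasCocycle hT x) (e : P.IsIsomorphic Q) : Q.HasCocycle hT x := by
  obtain ⟨y, hy⟩ := h
  obtain ⟨e, he⟩ := e
  have nat {U V : C} (f : V ⟶ U) (y : P.sheaf.obj.obj (op U)) :
      Q.sheaf.obj.map f.op (e.hom.hom.app (op U) y) =
        e.hom.hom.app (op V) (P.sheaf.obj.map f.op y) :=
    (ConcreteCategory.congr_hom (e.hom.hom.naturality f.op) y).symm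
  exact ⟨fun i ↦ e.hom.hom.app _ (y i), fun i k W a b ↦ by rw [nat, nat, hy i k a b, he]⟩

lemma HasCocycle.refine {P : Torsor J G} {𝒰 𝒱 : Covering.{j} J T} {c : 𝒰.Cocycle G}
    (h : P.HasCocycle hT ⟨𝒰, c⟩) (r : Covering.Refinement 𝒱 𝒰) :
    P.HasCocycle hT ⟨𝒱, c.refine r⟩ := by
  obtain ⟨y, hy⟩ := h
  refine ⟨fun i ↦ P.sheaf.obj.map (r.hom i).op (y (r.idx i)), fun i k W a b ↦ ?_⟩
  rw [← P.map_comp, ← P.map_comp, hy _ _ (a ≫ r.hom i) (b ≫ r.hom k)]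
  congr 1

lemma HasCocycle.of_isCohomologous {P : Torsor J G} {𝒰 : Covering.{j} J T} {c d : 𝒰.Cocycle G}
    (h : P.HasCocycle hT ⟨𝒰, c⟩) (e : PresheafOfGroups.OneCocycle.IsCohomologous c d) :
    P.HasCocycle hT ⟨𝒰, d⟩ := by
  obtain ⟨y, hy⟩ := h
  obtain ⟨α, hα⟩ := e
  let α' (i : 𝒰.I) : G.obj (op (𝒰.X i)) := α i
  -- From `α i * c = d * α k` one gets `y k * (α k)⁻¹ = y i * c * (α k)⁻¹ = y i * (α i)⁻¹ * d`.
  refine ⟨fun i ↦ P.act (y i) (α' i)⁻¹, fun i k W a b ↦ ?_⟩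
  have h : G.map a.op (α' i) * c.eval hT i k a b = d.eval hT i k a b * G.map b.op (α' k) :=
    hα i k (T := Over.mk (hT.from W)) (Over.homMk a (hT.hom_ext _ _))
      (Over.homMk b (hT.hom_ext _ _))
  rw [P.map_act, P.map_act, hy i k a b, ← P.act_mul, ← P.act_mul]
  congr 1
  rw [map_inv, map_inv, eq_inv_mul_iff_mul_eq, ← mul_assoc, mul_inv_eq_iff_eq_mul]
  exact h

/-- The two cocycles come from two systems of sections `y` and `z` of the same torsor; the elements
carrying `z i` to `y i` form the coboundary. -/
lemma HasCocycle.isCohomologous {P : Torsor J G} {𝒰 : Covering.{j} J T} {c d : 𝒰.Cocycle G}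
    (hc : P.HasCocycle hT ⟨𝒰, c⟩) (hd : P.HasCocycle hT ⟨𝒰, d⟩) :
    PresheafOfGroups.OneCocycle.IsCohomologous c d := by
  obtain ⟨y, hy⟩ := hc
  obtain ⟨z, hz⟩ := hd
  have key {W : C} (i k : 𝒰.I) (a : W ⟶ 𝒰.X i) (b : W ⟶ 𝒰.X k) :
      G.map a.op (P.diff (z i) (y i)) * c.eval hT i k a b =
        d.eval hT i k a b * G.map b.op (P.diff (z k) (y k)) := by
    refine P.act_injective (P.sheaf.obj.map a.op (z i)) ?_
    rw [map_diff, map_diff, P.act_mul, P.act_mul, P.act_diff, ← hz i k a b, ← hy i k a b,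
      P.act_diff]
  refine ⟨fun i ↦ P.diff (z i) (y i), fun i k W a b ↦ ?_⟩
  rw [Covering.Cocycle.ev_eq_eval hT, Covering.Cocycle.ev_eq_eval hT]
  exact key i k a.left b.left

/-- On a common refinement both become cocycles of one covering attached to the same torsor. The
refinement used consists of all objects with an arrow to a member of each covering, which is why the
index universe must contain the objects and arrows of `C`. -/
lemma HasCocycle.cechRel {P : Torsor J G} {x y : Σ 𝒰 : Covering.{max j u₁ v₁} J T, 𝒰.Cocycle G}
    (hx : P.HasCocycle hT x) (hy : P.HasCocycle hT y) : Covering.CechRel J G T x y := by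
  obtain ⟨𝒰, c⟩ := x
  obtain ⟨𝒱, d⟩ := y
  let I := Σ (i : 𝒰.I) (k : 𝒱.I) (W : C), (W ⟶ 𝒰.X i) × (W ⟶ 𝒱.X k)
  let 𝒲 : Covering.{max j u₁ v₁} J T :=
    { I := I
      X := fun m ↦ m.2.2.1
      π := fun m ↦ hT.from _
      mem := by
        refine J.superset_covering ?_ (J.intersection_covering 𝒰.mem 𝒱.mem)
        rintro W f ⟨⟨_, a, _, ⟨i⟩, -⟩, ⟨_, b, _, ⟨k⟩, -⟩⟩
        obtain rfl := hT.hom_ext (hT.from W) f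
        exact Sieve.ofArrows_mk (fun m : I ↦ m.2.2.1) (fun m ↦ hT.from _) ⟨i, k, W, a, b⟩ }
  let r : Covering.Refinement 𝒲 𝒰 := ⟨fun m ↦ m.1, fun m ↦ m.2.2.2.1, fun _ ↦ hT.hom_ext _ _⟩
  let t : Covering.Refinement 𝒲 𝒱 := ⟨fun m ↦ m.2.1, fun m ↦ m.2.2.2.2, fun _ ↦ hT.hom_ext _ _⟩
  exact ⟨𝒲, r, t, (hx.refine r).isCohomologous (hy.refine t)⟩

-- Local non-emptiness at `T` says that the objects over which `P` has a section cover `T`. One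
-- section is chosen over each, and the differences form the cocycle.
variable (hT) in
lemma exists_hasCocycle (P : Torsor J G) :
    ∃ x : Σ 𝒰 : Covering.{max j u₁} J T, 𝒰.Cocycle G, P.HasCocycle hT x := by
  let I := ULift.{j} {V : C // Nonempty (P.sheaf.obj.obj (op V))}
  let 𝒰 : Covering.{max j u₁} J T :=
    { I := I
      X := fun m ↦ m.down.1
      π := fun m ↦ hT.from _
      mem := by
        obtain ⟨R, hR, h⟩ := P.locally_nonempty T
        refine J.superset_covering ?_ hR
        intro W f hf
        obtain rfl := hT.hom_ext (hT.from W) f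
        exact Sieve.ofArrows_mk (fun m : I ↦ m.down.1) (fun m ↦ hT.from _) ⟨W, h _ hf⟩ }
  let y (i : 𝒰.I) : P.sheaf.obj.obj (op (𝒰.X i)) := i.down.2.some
  let c : 𝒰.Cocycle G :=
    { ev := fun i k W a b ↦ P.diff (P.sheaf.obj.map a.left.op (y i))
        (P.sheaf.obj.map b.left.op (y k))
      ev_precomp := fun i k W W' f a b ↦ by
        refine (P.map_diff f.left _ _).trans ?_
        rw [← P.map_comp, ← P.map_comp]
        rfl
      ev_trans := fun i k l W a b d ↦ P.diff_mul_diff _ _ _ }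
  exact ⟨⟨𝒰, c⟩, y, fun i k W a b ↦ (P.act_diff _ _).symm⟩

lemma HasCocycle.pullback {D : Type u₂} [Category.{v₂} D] {K : GrothendieckTopology D}
    {H : Dᵒᵖ ⥤ GrpCat.{w}} (F : D ⥤ C) [F.IsContinuous K J] [F.IsCocontinuous K J]
    (φ : F.op ⋙ G ≅ H) {T' : D} (hT' : IsTerminal T') (t : F.obj T' ⟶ T) {P : Torsor J G}
    {𝒰 : Covering.{j} J T} {c : 𝒰.Cocycle G} (h : P.HasCocycle hT ⟨𝒰, c⟩) :
    (P.pullback (K := K) F φ).HasCocycle hT' ⟨Covering.pullback K F t 𝒰, c.pullback K F φ t⟩ := by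
  obtain ⟨y, hy⟩ := h
  refine ⟨fun k ↦ P.sheaf.obj.map k.s.op (y k.i), fun k l W a b ↦ ?_⟩
  have h := hy k.i l.i (F.map a ≫ k.s) (F.map b ≫ l.s)
  rw [P.map_comp, P.map_comp] at h
  refine h.trans ?_
  refine congr_arg (P.act (U := F.obj W) _) ?_
  -- The pulled back group acts through `φ.inv`, which cancels the `φ.hom` in the pulled back
  -- cocycle.
  have e : φ.inv.app (op W) (φ.hom.app (op W) (c.eval hT k.i l.i (F.map a ≫ k.s) (F.map b ≫ l.s)))
      = c.eval hT k.i l.i (F.map a ≫ k.s) (F.map b ≫ l.s) :=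
    ConcreteCategory.congr_hom (φ.hom_inv_id_app (op W)) _
  rw [← e]
  exact congr_arg (fun z ↦ φ.inv.app (op W) (φ.hom.app (op W) z))
    (c.ev_eq_eval hT k.i l.i
      (Covering.pullbackHom F t 𝒰 k (W := Over.mk (hT'.from W)) (Over.homMk a (hT'.hom_ext _ _)))
      (Covering.pullbackHom F t 𝒰 l (Over.homMk b (hT'.hom_ext _ _)))).symm

end Torsor

end CechTorsor

/-! ### Shrinking the values of a presheaf -/

section Shrink

variable {C : Type u₁} [Category.{v₁} C]

/-- A presheaf with small values, moved to a smaller universe. -/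
@[simps]
noncomputable def shrinkPresheaf (F : Cᵒᵖ ⥤ Type s) [∀ V, Small.{w} (F.obj V)] :
    Cᵒᵖ ⥤ Type w where
  obj V := Shrink.{w} (F.obj V)
  map f := TypeCat.ofHom fun x ↦ equivShrink _ (F.map f ((equivShrink _).symm x))
  map_id V := by ext; simp
  map_comp f g := by ext; simp

lemma shrinkPresheaf_isSheaf {J : GrothendieckTopology C} {F : Cᵒᵖ ⥤ Type s}
    [∀ V, Small.{w} (F.obj V)] (hF : Presieve.IsSheaf J F) :
    Presieve.IsSheaf J (shrinkPresheaf F : Cᵒᵖ ⥤ Type w) :=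
  isSheaf_of_equiv hF (fun V ↦ equivShrink (F.obj (op V))) (fun _ _ f x ↦ by
    change _ = equivShrink _ (F.map f.op ((equivShrink _).symm (equivShrink _ x)))
    rw [Equiv.symm_apply_apply]
    rfl)

end Shrink

/-! ### The torsor attached to a cocycle -/

section Twist

variable {C : Type u₁} [Category.{v₁} C] {J : GrothendieckTopology C} {G : Cᵒᵖ ⥤ GrpCat.{w}}
  {T : C} (hT : IsTerminal T) {𝒰 : Covering.{j} J T} (c : 𝒰.Cocycle G)

namespace Covering

/-- The disjoint union of the presheaves represented by the members of a covering. -/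
@[simps]
def presheaf (𝒰 : Covering.{j} J T) : Cᵒᵖ ⥤ Type (max j v₁) where
  obj W := Σ i, (W.unop ⟶ 𝒰.X i)
  map g := TypeCat.ofHom fun b ↦ ⟨b.1, g.unop ≫ b.2⟩

variable (𝒰) in
lemma exists_mem (hT : IsTerminal T) (V : C) : ∃ R ∈ J V, ∀ ⦃W : C⦄ (f : W ⟶ V), R f →
    ∃ i, Nonempty (W ⟶ 𝒰.X i) := by
  refine ⟨_, J.pullback_stable (hT.from V) 𝒰.mem, ?_⟩
  rintro V f ⟨Z, a, b, ⟨i⟩, -⟩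
  exact ⟨i, ⟨a⟩⟩

namespace Cocycle

/-- The condition for a family of sections of `G` to define a section of the torsor attached to
a cocycle. -/
def IsTwisted ⦃W : C⦄ (h : 𝒰.presheaf.obj (op W) → (G ⋙ forget GrpCat).obj (op W)) : Prop :=
  ∀ b b' : Σ i, (W ⟶ 𝒰.X i), h b = (c.eval hT b.1 b'.1 b.2 b'.2 * h b' : G.obj (op W))

/-- The sections of the torsor attached to a cocycle. -/
abbrev Twist (V : C) := HomFamily 𝒰.presheaf (G ⋙ forget GrpCat) (c.IsTwisted hT) V

namespace Twist

variable {c hT}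

/-- The values of a section of the torsor attached to a cocycle. -/
abbrev value {V : C} (y : c.Twist hT V) {W : C} (f : W ⟶ V) (i : 𝒰.I) (a : W ⟶ 𝒰.X i) :
    G.obj (op W) := y.val f ⟨i, a⟩

lemma value_eq {V : C} (y : c.Twist hT V) {W : C} (f : W ⟶ V) (i k : 𝒰.I) (a : W ⟶ 𝒰.X i)
    (b : W ⟶ 𝒰.X k) : y.value f i a = c.eval hT i k a b * y.value f k b :=
  y.prop f ⟨i, a⟩ ⟨k, b⟩

lemma map_value {V : C} (y : c.Twist hT V) {W W' : C} (g : W' ⟶ W) (f : W ⟶ V) (i : 𝒰.I)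
    (a : W ⟶ 𝒰.X i) : G.map g.op (y.value f i a) = y.value (g ≫ f) i (g ≫ a) :=
  y.map_val g f ⟨i, a⟩

lemma ext' {V : C} {y z : c.Twist hT V}
    (h : ∀ ⦃W : C⦄ (f : W ⟶ V) (i : 𝒰.I) (a : W ⟶ 𝒰.X i), y.value f i a = z.value f i a) :
    y = z :=
  HomFamily.ext (by funext W f b; exact h f b.1 b.2)

/-- Constructor for sections of the torsor attached to a cocycle. -/
def mk {V : C} (v : ∀ ⦃W : C⦄ (_ : W ⟶ V) (i : 𝒰.I) (_ : W ⟶ 𝒰.X i), G.obj (op W))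
    (h : ∀ ⦃W W' : C⦄ (g : W' ⟶ W) (f : W ⟶ V) (i : 𝒰.I) (a : W ⟶ 𝒰.X i),
      G.map g.op (v f i a) = v (g ≫ f) i (g ≫ a))
    (h' : ∀ ⦃W : C⦄ (f : W ⟶ V) (i k : 𝒰.I) (a : W ⟶ 𝒰.X i) (b : W ⟶ 𝒰.X k),
      v f i a = c.eval hT i k a b * v f k b) : c.Twist hT V where
  val _ f b := v f b.1 b.2
  map_val _ _ g f b := h g f b.1 b.2
  prop _ f b b' := h' f b.1 b'.1 b.2 b'.2

/-- The action of the group on the torsor attached to a cocycle. -/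
def act {V : C} (y : c.Twist hT V) (g : G.obj (op V)) : c.Twist hT V :=
  mk (fun W f i a ↦ y.value f i a * G.map f.op g)
    (fun _ _ h f i a ↦ by rw [map_mul, map_value, op_comp, G.map_comp]; rfl)
    (fun _ f i k a b ↦ by rw [← mul_assoc, ← value_eq])

/-- A section of the torsor attached to a cocycle, over a member of the covering. -/
def ofIndex {V : C} (k : 𝒰.I) (b : V ⟶ 𝒰.X k) : c.Twist hT V :=
  mk (fun W f i a ↦ c.eval hT i k a (f ≫ b))
    (fun _ _ h f i a ↦ by rw [map_eval, Category.assoc])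
    (fun _ f i k a b ↦ by rw [eval_mul_eval])

/-- The covering may be indexed by an arbitrarily large type, but over each `W ⟶ V` the cocycle
relation recovers all values of a section from a single one. Sections thus embed into a product of
groups `G(W)` indexed by the arrows `W ⟶ V`. -/
instance [UnivLE.{max u₁ v₁, w}] (V : C) : Small.{w} (c.Twist hT V) := by
  classical
  have : UnivLE.{u₁, w} := UnivLE.trans.{u₁, max u₁ v₁, w}
  have : UnivLE.{v₁, w} := UnivLE.trans.{v₁, max u₁ v₁, w}
  let φ (y : c.Twist hT V) (W : C) (f : W ⟶ V) : G.obj (op W) :=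
    if h : Nonempty (Σ i, (W ⟶ 𝒰.X i)) then y.value f h.some.1 h.some.2 else 1
  refine small_of_injective (f := φ) fun y z h ↦ ext' fun W f i a ↦ ?_
  have hne : Nonempty (Σ i, (W ⟶ 𝒰.X i)) := ⟨⟨i, a⟩⟩
  have h₁ := congr_fun (congr_fun h W) f
  simp only [φ, dif_pos hne] at h₁
  rw [y.value_eq f i hne.some.1 a hne.some.2, z.value_eq f i hne.some.1 a hne.some.2, h₁]

end Twist

/-- The twisting condition is an equality of sections of the sheaf `G`, compatible with restriction,
so it can be checked locally. -/
lemma twist_isSheaf (hG : Presheaf.IsSheaf J G) :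
    Presieve.IsSheaf J (homFamilies 𝒰.presheaf (G ⋙ forget GrpCat) (c.IsTwisted hT)) := by
  refine homFamilies_isSheaf (isSheaf_forget_grp hG) fun W R hR y hy h b b' ↦ ?_
  refine ext_of_mem (isSheaf_forget_grp hG) hR fun W' g hg ↦ ?_
  have h₁ := h g hg (𝒰.presheaf.map g.op b) (𝒰.presheaf.map g.op b')
  rw [hy g b, h₁, ← hy g b']
  refine Eq.trans ?_ (map_mul (G.map g.op).hom _ _).symm
  congr 1
  exact (c.map_eval hT _ _ _ _ _).symm

variable {hT c} in
lemma Twist.act_injective (hG : Presheaf.IsSheaf J G) {V : C} (y : c.Twist hT V)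
    {g g' : G.obj (op V)} (h : y.act g = y.act g') : g = g' := by
  obtain ⟨R, hR, hne⟩ := 𝒰.exists_mem hT V
  refine ext_of_mem (isSheaf_forget_grp hG) hR fun W f hf ↦ ?_
  obtain ⟨i, ⟨a⟩⟩ := hne f hf
  exact mul_left_cancel (congr_arg (fun z : c.Twist hT V ↦ z.value f i a) h)

-- Passing from one index to another multiplies the values of `y` and of `z` on the left by the same
-- element, so `y⁻¹ * z` does not depend on the index and glues.
variable {hT c} in
lemma Twist.exists_act_eq (hG : Presheaf.IsSheaf J G) {V : C} (y z : c.Twist hT V) :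
    ∃ g, y.act g = z := by
  obtain ⟨R, hR, hne⟩ := 𝒰.exists_mem hT V
  obtain ⟨g, hg⟩ := exists_glue (isSheaf_forget_grp hG) (V := V)
    (fun W f g ↦ ∃ i, ∃ a : W ⟶ 𝒰.X i, y.value f i a * (g : G.obj (op W)) = z.value f i a)
    (by
      rintro W W' k f g ⟨i, a, h⟩
      refine ⟨i, k ≫ a, ?_⟩
      rw [← map_value, ← map_value, ← h]
      exact (map_mul (G.map k.op).hom _ _).symm)
    (by
      rintro W f g g' ⟨i, a, h⟩ ⟨k, b, h'⟩
      rw [y.value_eq f k i b a, z.value_eq f k i b a, mul_assoc] at h'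
      exact mul_left_cancel (h.trans (mul_left_cancel h').symm))
    R hR (by
      intro W f hf
      obtain ⟨i, ⟨a⟩⟩ := hne f hf
      exact ⟨(y.value f i a)⁻¹ * z.value f i a, i, a, mul_inv_cancel_left _ _⟩)
  refine ⟨g, ext' fun W f i a ↦ ?_⟩
  have h := hg f ((y.value f i a)⁻¹ * z.value f i a) ⟨i, a, mul_inv_cancel_left _ _⟩
  exact (congr_arg (fun x : G.obj (op W) ↦ y.value f i a * x) h).trans (mul_inv_cancel_left _ _)

variable [UnivLE.{max u₁ v₁, w}]

instance (V : Cᵒᵖ) : Small.{w}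
    ((homFamilies 𝒰.presheaf (G ⋙ forget GrpCat) (c.IsTwisted hT)).obj V) :=
  inferInstanceAs (Small.{w} (c.Twist hT V.unop))

/-- The torsor attached to a cocycle. -/
noncomputable def torsor (hG : Presheaf.IsSheaf J G) : Torsor J G where
  sheaf := ⟨shrinkPresheaf (homFamilies 𝒰.presheaf (G ⋙ forget GrpCat) (c.IsTwisted hT)),
    (isSheaf_iff_isSheaf_of_type J _).2 (shrinkPresheaf_isSheaf (twist_isSheaf hT c hG))⟩
  act {U} y g := equivShrink (c.Twist hT U) (((equivShrink (c.Twist hT U)).symm y).act g)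
  act_one {U} y := by
    refine (Equiv.eq_symm_apply _).1 (Twist.ext' fun W f i a ↦ ?_)
    change Twist.value _ _ _ _ * _ = _
    rw [map_one, mul_one]
    rfl
  act_mul {U} y g h := by
    refine congr_arg _ (Twist.ext' fun W f i a ↦ ?_)
    rw [Equiv.symm_apply_apply]
    change Twist.value _ _ _ _ * _ = (Twist.value _ _ _ _ * _) * _
    rw [map_mul, mul_assoc]
  map_act {U V} f y g := by
    refine congr_arg (equivShrink (c.Twist hT V)) (Twist.ext' fun W h i a ↦ ?_)
    have e₁ := (equivShrink (c.Twist hT U)).symm_apply_apply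
      (((equivShrink (c.Twist hT U)).symm y).act g)
    have e₂ := (equivShrink (c.Twist hT V)).symm_apply_apply
      (((equivShrink (c.Twist hT U)).symm y).restrict f)
    refine (congr_arg (fun z : c.Twist hT U ↦ z.value (h ≫ f) i a) e₁).trans
      (Eq.trans ?_ (congr_arg (fun z : c.Twist hT V ↦ z.value h i a * G.map h.op (G.map f.op g))
        e₂).symm)
    exact congr_arg (fun z ↦ Twist.value _ (h ≫ f) i a * z)
      (ConcreteCategory.congr_hom (G.map_comp f.op h.op) g)
  bijective U := by
    refine ⟨fun x y h ↦ ?_, fun x ↦ ?_⟩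
    · obtain ⟨h₁, h₂⟩ := Prod.ext_iff.1 h
      have h₁ : x.1 = y.1 := h₁
      refine Prod.ext h₁ (Twist.act_injective hG _ ((equivShrink (c.Twist hT U)).injective
        (h₂.trans ?_)))
      rw [h₁]
    · obtain ⟨g, hg⟩ := Twist.exists_act_eq hG ((equivShrink (c.Twist hT U)).symm x.1)
        ((equivShrink (c.Twist hT U)).symm x.2)
      exact ⟨(x.1, g), Prod.ext rfl ((Equiv.eq_symm_apply _).1 hg)⟩
  locally_nonempty U := by
    obtain ⟨R, hR, hne⟩ := 𝒰.exists_mem hT U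
    refine ⟨R, hR, fun V f hf ↦ ?_⟩
    obtain ⟨i, ⟨a⟩⟩ := hne f hf
    exact ⟨equivShrink (c.Twist hT V) (Twist.ofIndex i a)⟩

/-- Over the member with index `k` take the `k`-th column of the cocycle as section; the required
relation between the columns is the cocycle identity. -/
lemma torsor_hasCocycle (hG : Presheaf.IsSheaf J G) : (torsor hT c hG).HasCocycle hT ⟨𝒰, c⟩ := by
  refine ⟨fun i ↦ equivShrink (c.Twist hT (𝒰.X i)) (Twist.ofIndex i (𝟙 _)), fun i k W a b ↦ ?_⟩
  refine congr_arg (equivShrink (c.Twist hT W)) (Twist.ext' fun W' f l d ↦ ?_)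
  have e₁ := (equivShrink (c.Twist hT (𝒰.X k))).symm_apply_apply (Twist.ofIndex k (𝟙 _))
  have e₂ := (equivShrink (c.Twist hT (𝒰.X i))).symm_apply_apply (Twist.ofIndex i (𝟙 _))
  have e₃ := (equivShrink (c.Twist hT W)).symm_apply_apply
    (((equivShrink (c.Twist hT (𝒰.X i))).symm
      (equivShrink (c.Twist hT (𝒰.X i)) (Twist.ofIndex i (𝟙 _)))).restrict a)
  refine (congr_arg (fun z : c.Twist hT (𝒰.X k) ↦ z.value (f ≫ b) l d) e₁).trans
    (Eq.trans ?_ (congr_arg (fun z : c.Twist hT W ↦ z.value f l d *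
      G.map f.op (c.eval hT i k a b)) e₃).symm)
  refine Eq.trans ?_ (congr_arg (fun z : c.Twist hT (𝒰.X i) ↦ z.value (f ≫ a) l d *
      G.map f.op (c.eval hT i k a b)) e₂).symm
  change c.eval hT l k d ((f ≫ b) ≫ 𝟙 _) = c.eval hT l i d ((f ≫ a) ≫ 𝟙 _) * _
  rw [map_eval, Category.comp_id, Category.comp_id, eval_mul_eval]

/-- Send a section `p` to its coordinates, the `h i` with `p = y i * h i`. From `y k = y i * c`
follows `h i = c * h k`, which is the twisting condition, and an equivariant map of torsors is an
isomorphism. -/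
lemma isIsomorphic_torsor (hG : Presheaf.IsSheaf J G) {P : Torsor J G} (h : P.HasCocycle hT ⟨𝒰, c⟩) :
    P.IsIsomorphic (torsor hT c hG) := by
  obtain ⟨y, hy⟩ := h
  let φ (V : C) (p : P.sheaf.obj.obj (op V)) : c.Twist hT V :=
    Twist.mk (fun W f i a ↦ P.diff (P.sheaf.obj.map a.op (y i)) (P.sheaf.obj.map f.op p))
      (fun W W' g f i a ↦ by rw [P.map_diff, P.map_comp, P.map_comp])
      (fun W f i k a b ↦ by
        rw [← P.diff_eq (hy i k a b).symm, P.diff_mul_diff])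
  refine Torsor.isIsomorphic_of_hom _ _ (fun V p ↦ equivShrink (c.Twist hT V) (φ V p)) ?_ ?_
  · intro U V f p
    refine congr_arg (equivShrink (c.Twist hT V)) (Twist.ext' fun W g i a ↦ ?_)
    refine Eq.trans ?_ (congr_arg (fun z : c.Twist hT U ↦ z.value (g ≫ f) i a)
      ((equivShrink (c.Twist hT U)).symm_apply_apply (φ U p))).symm
    change P.diff _ _ = P.diff _ _
    rw [P.map_comp]
  · intro U p g
    refine congr_arg (equivShrink (c.Twist hT U)) (Twist.ext' fun W f i a ↦ ?_)
    refine Eq.trans ?_ (congr_arg (fun z : c.Twist hT U ↦ z.value f i a * G.map f.op g)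
      ((equivShrink (c.Twist hT U)).symm_apply_apply (φ U p))).symm
    change P.diff _ _ = P.diff _ _ * _
    rw [P.map_act, P.diff_act]

end Cocycle

end Covering

end Twist

/-! ### Čech classes of a final object are torsor classes -/

section CechComparison

variable {C : Type u₁} [Category.{v₁} C] {J : GrothendieckTopology C} {G : Cᵒᵖ ⥤ GrpCat.{w}}
  {T : C} (hT : IsTerminal T) [UnivLE.{max u₁ v₁, w}]

/-- The class of the torsor attached to a Čech cohomology class of a final object. -/
noncomputable def CechH1.toTorsorClasses (hG : Presheaf.IsSheaf J G) :
    CechH1.{j} J G T → TorsorClasses J G :=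
  Quot.lift (fun x ↦ Quotient.mk (Torsor.setoid J G) (x.2.torsor hT hG)) (by
    rintro ⟨𝒰, c⟩ ⟨𝒱, d⟩ ⟨𝒲, r, t, h⟩
    refine Quotient.sound ?_
    have h₁ := ((c.torsor_hasCocycle hT hG).refine r).of_isCohomologous h
    have h₂ := (d.torsor_hasCocycle hT hG).refine t
    exact (Torsor.isIsomorphic_equivalence J G).trans
      (Covering.Cocycle.isIsomorphic_torsor hT _ hG h₁) ((Torsor.isIsomorphic_equivalence J G).symm
        (Covering.Cocycle.isIsomorphic_torsor hT _ hG h₂)))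

lemma CechH1.toTorsorClasses_injective (hG : Presheaf.IsSheaf J G) :
    Function.Injective (CechH1.toTorsorClasses.{max j u₁ v₁} hT hG) := by
  rintro ⟨x⟩ ⟨y⟩ h
  have e : (x.2.torsor hT hG).IsIsomorphic (y.2.torsor hT hG) := Quotient.exact h
  exact Quot.sound (((x.2.torsor_hasCocycle hT hG).of_isIsomorphic e).cechRel.{j}
    (y.2.torsor_hasCocycle hT hG))

lemma CechH1.toTorsorClasses_surjective (hG : Presheaf.IsSheaf J G) :
    Function.Surjective (CechH1.toTorsorClasses.{max j u₁} hT hG) := by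
  rintro ⟨P⟩
  obtain ⟨x, hx⟩ := Torsor.exists_hasCocycle.{j} hT P
  exact ⟨Quot.mk _ x, Quotient.sound ((Torsor.isIsomorphic_equivalence J G).symm
    (Covering.Cocycle.isIsomorphic_torsor hT _ hG hx))⟩

/-- The pulled back torsor has the pulled back cocycle, so it is isomorphic to the twist by it. -/
lemma CechH1.toTorsorClasses_map {D : Type u₂} [Category.{v₂} D] {K : GrothendieckTopology D}
    {H : Dᵒᵖ ⥤ GrpCat.{w}} [UnivLE.{max u₂ v₂, w}] (F : D ⥤ C) [F.IsContinuous K J]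
    [F.IsCocontinuous K J] (φ : F.op ⋙ G ≅ H) {T' : D} (hT' : IsTerminal T') (t : F.obj T' ⟶ T)
    (hG : Presheaf.IsSheaf J G) (hH : Presheaf.IsSheaf K H) (x : CechH1.{j} J G T) :
    CechH1.toTorsorClasses hT' hH (CechH1.map F φ t x) =
      TorsorClasses.map F φ (CechH1.toTorsorClasses hT hG x) := by
  obtain ⟨x⟩ := x
  exact Quotient.sound ((Torsor.isIsomorphic_equivalence K H).symm
    (Covering.Cocycle.isIsomorphic_torsor hT' _ hH
      ((x.2.torsor_hasCocycle hT hG).pullback F φ hT' t)))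

end CechComparison

/-! ### Comparing the obstructions of two functors -/

section Obstruction

variable {𝒮 : Type u} [Category.{v₃} 𝒮]

/-- Compatible comparison maps identify the obstructions of two functors. -/
lemma obstruction_eq {𝒳 : BasedCategory.{v₁, u₁} 𝒮} {𝒜 : BasedCategory.{v₂, u₂} 𝒮}
    {FX FA FS FX' FA' FS' : Type*} {ev : (𝒜 ⥤ᵇ 𝒳) → FX → FA} {q : FS → FA}
    {ev' : (𝒜 ⥤ᵇ 𝒳) → FX' → FA'} {q' : FS' → FA'} (eX : FX → FX') (eA : FA → FA') (eS : FS → FS')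
    (hX : Function.Surjective eX) (hA : Function.Injective eA) (hS : Function.Surjective eS)
    (hev : ∀ x A, eA (ev x A) = ev' x (eX A)) (hq : ∀ A, eA (q A) = q' (eS A)) :
    obstruction ev q = obstruction ev' q' := by
  ext x
  constructor
  · intro h A
    obtain ⟨A, rfl⟩ := hX A
    obtain ⟨s, hs⟩ := h A
    exact ⟨eS s, by rw [← hq, hs, hev]⟩
  · intro h A
    obtain ⟨s, hs⟩ := h (eX A)
    obtain ⟨s, rfl⟩ := hS s
    exact ⟨s, hA (by rw [hq, hs, hev])⟩

end Obstruction

/-! ### The Čech comparison for fibred categories -/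

section Fibred

variable {𝒮 : Type u₁} [Category.{v₁} 𝒮] (J : GrothendieckTopology 𝒮)
  (𝒯 : BasedCategory.{v₂, u₂} 𝒮) [IsFibredInGroupoids 𝒯.p]

lemma coeff_isSheaf {G : 𝒮ᵒᵖ ⥤ GrpCat.{w}} (hG : Presheaf.IsSheaf J G) :
    Presheaf.IsSheaf (inheritedTopology J 𝒯.p) (coeff G 𝒯) :=
  𝒯.p.op_comp_isSheaf _ J ⟨G, hG⟩

/-- The class of the torsor attached to a Čech cohomology class of a fibred category with a
final object. -/
noncomputable def FibCechH1.toTorsorClasses (hw : UnivLE.{max u₂ v₂, w}) [HasTerminal 𝒯.obj]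
    {G : 𝒮ᵒᵖ ⥤ GrpCat.{w}} (hG : Presheaf.IsSheaf J G) :
    FibCechH1.{j} J 𝒯 G → FibTorsorClasses J 𝒯 G :=
  CechH1.toTorsorClasses terminalIsTerminal (coeff_isSheaf J 𝒯 hG)

lemma FibCechH1.toTorsorClasses_injective (hw : UnivLE.{max u₂ v₂, w}) [HasTerminal 𝒯.obj]
    {G : 𝒮ᵒᵖ ⥤ GrpCat.{w}} (hG : Presheaf.IsSheaf J G) :
    Function.Injective (FibCechH1.toTorsorClasses.{max j u₂ v₂} J 𝒯 hw hG) :=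
  CechH1.toTorsorClasses_injective.{j} _ _

lemma FibCechH1.toTorsorClasses_surjective (hw : UnivLE.{max u₂ v₂, w}) [HasTerminal 𝒯.obj]
    {G : 𝒮ᵒᵖ ⥤ GrpCat.{w}} (hG : Presheaf.IsSheaf J G) :
    Function.Surjective (FibCechH1.toTorsorClasses.{max j u₂ v₂} J 𝒯 hw hG) :=
  CechH1.toTorsorClasses_surjective.{max j v₂} _ _

lemma FibCechH1.toTorsorClasses_map {𝒯' : BasedCategory.{v₃, u₃} 𝒮} [IsFibredInGroupoids 𝒯'.p]
    (f : 𝒯' ⥤ᵇ 𝒯) [HasTerminal 𝒯.obj] [HasTerminal 𝒯'.obj] (hw : UnivLE.{max u₂ v₂, w})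
    (hw' : UnivLE.{max u₃ v₃, w}) {G : 𝒮ᵒᵖ ⥤ GrpCat.{w}} (hG : Presheaf.IsSheaf J G)
    (A : FibCechH1.{j} J 𝒯 G) :
    FibCechH1.toTorsorClasses J 𝒯' hw' hG (FibCechH1.map J f G A) =
      FibTorsorClasses.map J f G (FibCechH1.toTorsorClasses J 𝒯 hw hG A) :=
  CechH1.toTorsorClasses_map _ f.toFunctor (coeffIso G f) _ _ _ _ A

end Fibred

section Schemes

variable (τ : Topo) {S : Scheme.{u}}
  (𝒳 : BasedCategory.{v₁, u₁} (Over S)) (𝒜 : BasedCategory.{v₂, u₂} (Over S))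
  [IsFibredInGroupoids 𝒳.p] [IsFibredInGroupoids 𝒜.p]

/-- The comparison maps go from Čech classes to torsor classes, so `obstruction_eq` gives the
equality in the opposite direction. The base `Over S` has its own final object, so the structure map
of `𝒜` is treated like any `x`. -/
lemma torsorObstruction_eq_cechObstruction [IsRepresentable 𝒳] [IsRepresentable 𝒜]
    [hwX : UnivLE.{max u₁ v₁, w}] [hwA : UnivLE.{max u₂ v₂, w}] [hwS : UnivLE.{u + 1, w}]
    {G : (Over S)ᵒᵖ ⥤ GrpCat.{w}} (hG : Presheaf.IsSheaf (τ.big S) G) :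
    torsorObstruction τ 𝒳 𝒜 G = cechObstruction τ 𝒳 𝒜 G := by
  have := hasTerminal_of_isRepresentable 𝒳
  have := hasTerminal_of_isRepresentable 𝒜
  exact (obstruction_eq
    (FibCechH1.toTorsorClasses.{max (u + 1) u₁ v₁ u₂ v₂} (τ.big S) 𝒳 hwX hG)
    (FibCechH1.toTorsorClasses.{max (u + 1) u₁ v₁ u₂ v₂} (τ.big S) 𝒜 hwA hG)
    (FibCechH1.toTorsorClasses.{max (u + 1) u₁ v₁ u₂ v₂} (τ.big S) (base (Over S)) hwS hG)
    (FibCechH1.toTorsorClasses_surjective.{max (u + 1) u₁ v₁ u₂ v₂} _ 𝒳 hwX _)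
    (FibCechH1.toTorsorClasses_injective.{max (u + 1) u₁ v₁ u₂ v₂} _ 𝒜 hwA _)
    (FibCechH1.toTorsorClasses_surjective.{max (u + 1) u₁ v₁ u₂ v₂} _ _ hwS _)
    (fun x A ↦ FibCechH1.toTorsorClasses_map (τ.big S) 𝒳 x hwX hwA hG A)
    (fun A ↦ FibCechH1.toTorsorClasses_map (τ.big S) _ (structureMap 𝒜) hwS hwA hG A)).symm

end Schemes

/-! ### Čech cohomology under a change of universe of the coefficients -/

section CechCongr

variable {C : Type u₁} [Category.{v₁} C] {J : GrothendieckTopology C}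

/-- An isomorphism of presheaves of groups in possibly different universes. -/
structure GroupEquiv (G : Cᵒᵖ ⥤ GrpCat.{w}) (G' : Cᵒᵖ ⥤ GrpCat.{w'}) where
  equiv (V : C) : G.obj (op V) ≃* G'.obj (op V)
  map_equiv ⦃V W : C⦄ (f : W ⟶ V) (g : G.obj (op V)) :
    equiv W (G.map f.op g) = G'.map f.op (equiv V g)

variable {G : Cᵒᵖ ⥤ GrpCat.{w}} {G' : Cᵒᵖ ⥤ GrpCat.{w'}}

/-- The inverse isomorphism. -/
def GroupEquiv.symm (e : GroupEquiv G G') : GroupEquiv G' G where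
  equiv V := (e.equiv V).symm
  map_equiv V W f g := by
    rw [MulEquiv.symm_apply_eq, e.map_equiv, MulEquiv.apply_symm_apply]

/-- The pull-back of an isomorphism of presheaves of groups. -/
def GroupEquiv.comp (e : GroupEquiv G G') {D : Type u₂} [Category.{v₂} D] (F : D ⥤ C) :
    GroupEquiv (F.op ⋙ G) (F.op ⋙ G') where
  equiv V := e.equiv (F.obj V)
  map_equiv _ _ f g := e.map_equiv (F.map f) g

variable {T : C}

lemma Covering.Cocycle.ext_ev {𝒰 : Covering.{j} J T} {c d : 𝒰.Cocycle G}
    (h : ∀ i k (W : Over T) (a : W ⟶ Over.mk (𝒰.π i)) (b : W ⟶ Over.mk (𝒰.π k)),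
      c.ev i k a b = d.ev i k a b) : c = d := by
  obtain ⟨c, _⟩ := c
  obtain ⟨d, _⟩ := d
  congr 1
  ext i k W a b
  exact h i k W a b

/-- The Čech cohomology class of a cocycle. -/
def CechH1.mk {𝒰 : Covering.{j} J T} (c : 𝒰.Cocycle G) : CechH1.{j} J G T := Quot.mk _ ⟨𝒰, c⟩

/-- Transport of Čech cocycles along an isomorphism of presheaves of groups. -/
def Covering.Cocycle.congr (e : GroupEquiv G G') {𝒰 : Covering.{j} J T} (c : 𝒰.Cocycle G) :
    𝒰.Cocycle G' where
  ev i k W a b := e.equiv W.left (c.ev i k a b)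
  ev_precomp i k W W' f a b := by
    rw [← c.ev_precomp]
    exact (e.map_equiv f.left _).symm
  ev_trans i k l W a b d := by
    rw [← c.ev_trans i k l a b d]
    exact (map_mul (e.equiv W.left) _ _).symm

lemma Covering.CechRel.congr (e : GroupEquiv G G') {x y : Σ 𝒰 : Covering.{j} J T, 𝒰.Cocycle G}
    (h : CechRel J G T x y) : CechRel J G' T ⟨x.1, x.2.congr e⟩ ⟨y.1, y.2.congr e⟩ := by
  obtain ⟨𝒲, r, t, α, h⟩ := h
  refine ⟨𝒲, r, t, fun i ↦ e.equiv _ (α i), fun i k W a b ↦ ?_⟩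
  have key := congr_arg (e.equiv W.left) (h i k a b)
  refine (congr_arg (fun z : G'.obj (op W.left) ↦ z * _) (e.map_equiv a.left (α i)).symm).trans
    (Eq.trans ?_ (congr_arg (fun z : G'.obj (op W.left) ↦ _ * z) (e.map_equiv b.left (α k))))
  exact (map_mul (e.equiv W.left) _ _).symm.trans (key.trans (map_mul (e.equiv W.left) _ _))

/-- Čech cohomology only depends on the coefficients up to isomorphism. -/
def CechH1.congr (e : GroupEquiv G G') : CechH1.{j} J G T ≃ CechH1.{j} J G' T where
  toFun := Quot.map (fun x ↦ ⟨x.1, x.2.congr e⟩) (fun _ _ h ↦ h.congr e)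
  invFun := Quot.map (fun x ↦ ⟨x.1, x.2.congr e.symm⟩) (fun _ _ h ↦ h.congr e.symm)
  left_inv := by
    rintro ⟨𝒰, c⟩
    exact congr_arg CechH1.mk (Covering.Cocycle.ext_ev (c := (c.congr e).congr e.symm)
      fun i k W a b ↦ (e.equiv W.left).symm_apply_apply _)
  right_inv := by
    rintro ⟨𝒰, c⟩
    exact congr_arg CechH1.mk (Covering.Cocycle.ext_ev (c := (c.congr e.symm).congr e)
      fun i k W a b ↦ (e.equiv W.left).apply_symm_apply _)

lemma CechH1.congr_map {D : Type u₂} [Category.{v₂} D] {K : GrothendieckTopology D}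
    {H : Dᵒᵖ ⥤ GrpCat.{w}} {H' : Dᵒᵖ ⥤ GrpCat.{w'}} (e : GroupEquiv G G') (e' : GroupEquiv H H')
    (F : D ⥤ C) [F.IsCocontinuous K J] (φ : F.op ⋙ G ≅ H) (φ' : F.op ⋙ G' ≅ H')
    (h : ∀ (V : D) (g : G.obj (op (F.obj V))),
      e'.equiv V (φ.hom.app (op V) g) = φ'.hom.app (op V) (e.equiv _ g))
    {T' : D} (t : F.obj T' ⟶ T) (x : CechH1.{j} J G T) :
    CechH1.congr e' (CechH1.map (K := K) F φ t x) =
      CechH1.map (K := K) F φ' t (CechH1.congr e x) := by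
  obtain ⟨𝒰, c⟩ := x
  exact congr_arg CechH1.mk (Covering.Cocycle.ext_ev (c := (c.pullback K F φ t).congr e')
    (d := (c.congr e).pullback K F φ' t) fun i k W a b ↦ h W.left _)

end CechCongr

section Fibred

variable {𝒮 : Type u₁} [Category.{v₁} 𝒮] (J : GrothendieckTopology 𝒮)
  {𝒯 : BasedCategory.{v₂, u₂} 𝒮} [IsFibredInGroupoids 𝒯.p]
  {𝒯' : BasedCategory.{v₃, u₃} 𝒮} [IsFibredInGroupoids 𝒯'.p] (f : 𝒯' ⥤ᵇ 𝒯)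
  [HasTerminal 𝒯.obj] [HasTerminal 𝒯'.obj]

lemma FibCechH1.congr_map {G : 𝒮ᵒᵖ ⥤ GrpCat.{w}} {G' : 𝒮ᵒᵖ ⥤ GrpCat.{w'}} (e : GroupEquiv G G')
    (A : FibCechH1.{j} J 𝒯 G) :
    CechH1.congr (e.comp 𝒯'.p) (FibCechH1.map J f G A) =
      FibCechH1.map J f G' (CechH1.congr (e.comp 𝒯.p) A) :=
  CechH1.congr_map _ _ f.toFunctor (coeffIso G f) (coeffIso G' f) (fun _ g ↦ e.map_equiv _ g) _ A

end Fibred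

section Schemes

variable (τ : Topo) {S : Scheme.{u}}
  (𝒳 : BasedCategory.{v₁, u₁} (Over S)) (𝒜 : BasedCategory.{v₂, u₂} (Over S))
  [IsFibredInGroupoids 𝒳.p] [IsFibredInGroupoids 𝒜.p]

lemma cechObstruction_congr [IsRepresentable 𝒳] [IsRepresentable 𝒜]
    {G : (Over S)ᵒᵖ ⥤ GrpCat.{w}} {G' : (Over S)ᵒᵖ ⥤ GrpCat.{w'}} (e : GroupEquiv G G') :
    cechObstruction τ 𝒳 𝒜 G = cechObstruction τ 𝒳 𝒜 G' := by
  have := hasTerminal_of_isRepresentable 𝒳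
  have := hasTerminal_of_isRepresentable 𝒜
  exact obstruction_eq (CechH1.congr (e.comp 𝒳.p)) (CechH1.congr (e.comp 𝒜.p))
    (CechH1.congr (e.comp (base (Over S)).p)) (CechH1.congr _).surjective
    (CechH1.congr _).injective (CechH1.congr _).surjective
    (fun x A ↦ FibCechH1.congr_map _ x e A)
    (fun A ↦ FibCechH1.congr_map _ (structureMap 𝒜) e A)

end Schemes

/-! ### Adelic points: descent set and classical descent set -/

section Descent

variable {C : Type u₁} [Category.{v₁} C] {J : GrothendieckTopology C}

lemma isSheaf_grp_of_forget {G : Cᵒᵖ ⥤ GrpCat.{w}}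
    (hG : Presieve.IsSheaf J (G ⋙ forget GrpCat.{w})) : Presheaf.IsSheaf J G := by
  intro E V R hR x hx
  let x' ⦃W : C⦄ (f : W ⟶ V) (hf : R f) : E ⟶ G.obj (op W) := x f hf
  have key (e : E) : ∃ y : G.obj (op V), ∀ ⦃W : C⦄ (f : W ⟶ V) (hf : R f),
      G.map f.op y = x' f hf e := by
    obtain ⟨y, hy, -⟩ := hG R hR (fun W f hf ↦ x' f hf e) (by
      intro W₁ W₂ Z g₁ g₂ f₁ f₂ h₁ h₂ h
      exact ConcreteCategory.congr_hom (hx g₁ g₂ h₁ h₂ h) e)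
    exact ⟨y, hy⟩
  choose y hy using key
  have hext {a b : G.obj (op V)} (h : ∀ ⦃W : C⦄ (f : W ⟶ V), R f → G.map f.op a = G.map f.op b) :
      a = b := ext_of_mem (F := G ⋙ forget _) hG hR h
  refine ⟨GrpCat.ofHom (MonoidHom.mk' y fun a b ↦ hext fun W f hf ↦ ?_), ?_, ?_⟩
  · rw [hy _ f hf, map_mul, map_mul, hy _ f hf, hy _ f hf]
  · intro W f hf
    change GrpCat.ofHom _ ≫ G.map f.op = x' f hf
    ext e
    exact hy e f hf
  · intro z hz
    change (show E ⟶ G.obj (op V) from z) = _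
    ext e
    refine hext fun W f hf ↦ ?_
    exact (ConcreteCategory.congr_hom (hz f hf) e).trans (hy e f hf).symm

/-- The change of universe of a presheaf of groups. -/
def GroupEquiv.ulift (G : Cᵒᵖ ⥤ GrpCat.{w}) :
    GroupEquiv (G ⋙ GrpCat.uliftFunctor.{w', w}) G where
  equiv _ := MulEquiv.ulift
  map_equiv _ _ _ _ := rfl

lemma isSheaf_ulift {G : Cᵒᵖ ⥤ GrpCat.{w}} (hG : Presieve.IsSheaf J (G ⋙ forget GrpCat.{w})) :
    Presheaf.IsSheaf J (G ⋙ GrpCat.uliftFunctor.{w', w}) :=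
  isSheaf_grp_of_forget (isSheaf_of_equiv hG (fun _ ↦ Equiv.ulift.symm) (fun _ _ _ _ ↦ rfl))

lemma isSheaf_yonedaGrpObj [CartesianMonoidalCategory C] [J.Subcanonical] (G : C) [GrpObj G] :
    Presieve.IsSheaf J (yonedaGrpObj G ⋙ forget GrpCat.{v₁}) :=
  GrothendieckTopology.Subcanonical.isSheaf_of_isRepresentable (J := J) (yoneda.obj G)

instance (S : Scheme.{u}) : (Topo.fppf.big S).Subcanonical :=
  inferInstanceAs (Scheme.fppfTopology.over S).Subcanonical

/-- The functor of points of `G` is a sheaf because the fppf topology is subcanonical. Its values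
lie in universe `u`, while `descSet` ranges over sheaves in universe `u + 1`, so it is lifted, the
torsor condition is turned into the Čech condition, and the lift is then removed. -/
lemma descSet_subset_classicalDescSet (k : Type u) [Field k] [NumberField k]
    (X : Over (Spec (.of k))) : descSet k X ⊆ classicalDescSet k X := by
  intro x hx G _ _
  have hG : Presheaf.IsSheaf (Topo.fppf.big (Spec (.of k)))
      (yonedaGrpObj G ⋙ GrpCat.uliftFunctor.{u + 1, u}) :=
    isSheaf_ulift (isSheaf_yonedaGrpObj G)
  have h : torsorObstruction .fppf (represented X) (represented (adeles k)) _
    (representedMap x) := hx ⟨_, hG⟩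
  rwa [torsorObstruction_eq_cechObstruction _ _ _ hG,
    cechObstruction_congr _ _ _ (GroupEquiv.ulift _)] at h

end Descent

noncomputable section

/-! ### Exactness on sections, and global sections as maps from `ℤ` -/

section AbelianSheaves

variable {C : Type u₁} [Category.{v₁} C] {J : GrothendieckTopology C}

instance enoughInjectives_ab (J : GrothendieckTopology C) [UnivLE.{max u₁ v₁, w}] :
    EnoughInjectives (Sheaf J AddCommGrpCat.{w}) := by
  have := essentiallySmall_of_univLE.{v₁, u₁, w} C
  have := Sheaf.isGrothendieckAbelian_of_essentiallySmall J AddCommGrpCat.{w}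
  exact IsGrothendieckAbelian.enoughInjectives

lemma wEqualsLocallyBijective_ab (J : GrothendieckTopology C) [UnivLE.{max u₁ v₁, w}] :
    J.WEqualsLocallyBijective AddCommGrpCat.{w} := by
  have := essentiallySmall_of_univLE.{v₁, u₁, w} C
  exact GrothendieckTopology.WEqualsLocallyBijective.ofEssentiallySmall J

lemma exists_local_lift [UnivLE.{max u₁ v₁, w}] {M Q : Sheaf J AddCommGrpCat.{w}} (f : M ⟶ Q)
    [Epi f] {V : C} (q : Q.obj.obj (op V)) :
    ∃ R ∈ J V, ∀ ⦃W : C⦄ (g : W ⟶ V), R g → ∃ m, f.hom.app (op W) m = Q.obj.map g.op q := by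
  have := wEqualsLocallyBijective_ab.{v₁, u₁, w} J
  have h : Sheaf.IsLocallySurjective f := (Sheaf.isLocallySurjective_iff_epi' _ f).2 inferInstance
  exact ⟨_, Presheaf.imageSieve_mem J f.hom q, fun W g hg ↦ hg⟩

lemma app_injective {A M : Sheaf J AddCommGrpCat.{w}} (f : A ⟶ M) [Mono f] (V : C) :
    Function.Injective (f.hom.app (op V)) := by
  have h : Mono ((sheafToPresheaf J AddCommGrpCat.{w} ⋙ (evaluation _ _).obj (op V)).map f) :=
    inferInstance
  exact (AddCommGrpCat.mono_iff_injective _).1 h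

/-- Taking sections over `V` preserves kernels, so exactness on the left survives. -/
lemma exists_app_eq [UnivLE.{max u₁ v₁, w}] {S : ShortComplex (Sheaf J AddCommGrpCat.{w})}
    (hS : S.ShortExact) {V : C} (m : S.X₂.obj.obj (op V)) (hm : S.g.hom.app (op V) m = 0) :
    ∃ a, S.f.hom.app (op V) a = m :=
  (ShortComplex.ab_exact_iff _).1 (hS.exact.map_of_mono_of_preservesKernel
    (sheafToPresheaf J AddCommGrpCat.{w} ⋙ (evaluation _ _).obj (op V)) hS.mono_f inferInstance)
    m hm

lemma app_map {A M : Sheaf J AddCommGrpCat.{w}} (f : A ⟶ M) {V W : C} (g : W ⟶ V)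
    (a : A.obj.obj (op V)) :
    f.hom.app (op W) (A.obj.map g.op a) = M.obj.map g.op (f.hom.app (op V) a) :=
  ConcreteCategory.congr_hom (f.hom.naturality g.op) a

section GlobalSections

lemma ulift_hom_ext {A : AddCommGrpCat.{w}} {f g : AddCommGrpCat.of (ULift.{w} ℤ) ⟶ A}
    (h : f (ULift.up (1 : ℤ)) = g (ULift.up (1 : ℤ))) : f = g :=
  (AddCommGrpCat.coyonedaObjIsoForget.app A).toEquiv.injective h

lemma exists_ulift_hom (A : AddCommGrpCat.{w}) (a : A) :
    ∃ f : AddCommGrpCat.of (ULift.{w} ℤ) ⟶ A, f (ULift.up (1 : ℤ)) = a :=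
  (AddCommGrpCat.coyonedaObjIsoForget.app A).toEquiv.surjective a

variable [UnivLE.{max u₁ v₁, w}] {Q Q' : Sheaf J AddCommGrpCat.{w}}

variable (J) in
/-- The section `1` of the constant sheaf `ℤ`. -/
def oneSection (V : C) : (constZ.{v₁, u₁, w} J).obj.obj (op V) :=
  (toSheafify J ((Functor.const Cᵒᵖ).obj (AddCommGrpCat.of (ULift.{w} ℤ)))).app (op V)
    (ULift.up (1 : ℤ))

lemma map_oneSection {V W : C} (f : W ⟶ V) :
    (constZ.{v₁, u₁, w} J).obj.map f.op (oneSection J V) = oneSection J W :=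
  (ConcreteCategory.congr_hom ((toSheafify J ((Functor.const Cᵒᵖ).obj
    (AddCommGrpCat.of (ULift.{w} ℤ)))).naturality f.op) (ULift.up (1 : ℤ))).symm

/-- The value on `V` of the global section corresponding to a morphism from the
constant sheaf `ℤ`. -/
def globalSection (s : constZ J ⟶ Q) (V : C) : Q.obj.obj (op V) :=
  s.hom.app (op V) (oneSection J V)

lemma map_globalSection (s : constZ J ⟶ Q) {V W : C} (f : W ⟶ V) :
    Q.obj.map f.op (globalSection s V) = globalSection s W := by
  rw [globalSection, ← app_map, map_oneSection, globalSection]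

lemma globalSection_comp (s : constZ J ⟶ Q) (g : Q ⟶ Q') (V : C) :
    globalSection (s ≫ g) V = g.hom.app (op V) (globalSection s V) := rfl

lemma globalSection_sub (s s' : constZ J ⟶ Q) (V : C) :
    globalSection (s - s') V = globalSection s V - globalSection s' V := rfl

/-- Morphisms from the constant sheaf `ℤ` are morphisms from the constant presheaf. -/
def constZHomEquiv (Q : Sheaf J AddCommGrpCat.{w}) : (constZ J ⟶ Q) ≃
    ((Functor.const Cᵒᵖ).obj (AddCommGrpCat.of (ULift.{w} ℤ)) ⟶ Q.obj) :=
  (sheafificationAdjunction J AddCommGrpCat.{w}).homEquiv _ _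

lemma constZHomEquiv_app (s : constZ J ⟶ Q) (V : C) :
    (constZHomEquiv Q s).app (op V) (ULift.up (1 : ℤ)) = globalSection s V := by
  have h := (sheafificationAdjunction J AddCommGrpCat.{w}).homEquiv_unit
    (X := (Functor.const Cᵒᵖ).obj (AddCommGrpCat.of (ULift.{w} ℤ))) (Y := Q) (f := s)
  exact congr_arg (fun g ↦ g.app (op V) (ULift.up (1 : ℤ))) h

lemma globalSection_ext {s s' : constZ J ⟶ Q} (h : ∀ V, globalSection s V = globalSection s' V) :
    s = s' := by
  refine (constZHomEquiv Q).injective ?_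
  ext V : 2
  refine ulift_hom_ext ?_
  exact (constZHomEquiv_app s V.unop).trans ((h V.unop).trans (constZHomEquiv_app s' V.unop).symm)

/-- Without a final object, a global section means a compatible family of sections. Such a family is
a map from the constant presheaf `ℤ`, hence from its sheafification. -/
lemma exists_globalSection (q : ∀ V : C, Q.obj.obj (op V))
    (hq : ∀ ⦃V W : C⦄ (f : W ⟶ V), Q.obj.map f.op (q V) = q W) :
    ∃ s : constZ J ⟶ Q, ∀ V, globalSection s V = q V := by
  choose e he using fun V : C ↦ exists_ulift_hom (Q.obj.obj (op V)) (q V)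
  let f : (Functor.const Cᵒᵖ).obj (AddCommGrpCat.of (ULift.{w} ℤ)) ⟶ Q.obj :=
    { app := fun V ↦ e V.unop
      naturality := fun V W g ↦ by
        refine ulift_hom_ext ?_
        change e W.unop (ULift.up (1 : ℤ)) = Q.obj.map g (e V.unop (ULift.up (1 : ℤ)))
        rw [he, he]
        exact (hq g.unop).symm }
  refine ⟨(constZHomEquiv Q).symm f, fun V ↦ ?_⟩
  rw [← constZHomEquiv_app, Equiv.apply_symm_apply]
  exact he V

variable {D : Type u₂} [Category.{v₂} D] [UnivLE.{max u₂ v₂, w}] {K : GrothendieckTopology D}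

lemma globalSection_constZHom (F : D ⥤ C) [F.IsContinuous K J] (V : D) :
    globalSection (constZHom J K F) V = oneSection J (F.obj V) := by
  rw [← constZHomEquiv_app]
  have h : constZHomEquiv _ (constZHom J K F) = Functor.whiskerLeft F.op
      (toSheafify J ((Functor.const Cᵒᵖ).obj (AddCommGrpCat.of (ULift.{w} ℤ)))) :=
    ((sheafificationAdjunction K AddCommGrpCat.{w}).homEquiv _ _).apply_symm_apply _
  rw [h]
  rfl

lemma globalSection_pullback (F : D ⥤ C) [F.IsContinuous K J] (s : constZ J ⟶ Q) (V : D) :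
    globalSection (constZHom J K F ≫
      (F.sheafPushforwardContinuous AddCommGrpCat.{w} K J).map s) V =
      globalSection s (F.obj V) :=
  congr_arg (s.hom.app (op (F.obj V))) (globalSection_constZHom F V)

end GlobalSections

end AbelianSheaves

end

noncomputable section

/-! ### Torsors as fibres of an epimorphism of abelian sheaves -/

section AbelianTorsors

variable {C : Type u₁} [Category.{v₁} C] {J : GrothendieckTopology C}
  {A M M' : Sheaf J AddCommGrpCat.{w}}

/-- Sections of a sheaf of abelian groups, as sections of the underlying sheaf of groups. -/
def toAb {U : C} : (groupOfAb J A).obj (op U) ≃ A.obj.obj (op U) := Multiplicative.toAdd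

lemma toAb_one {U : C} : toAb (1 : (groupOfAb J A).obj (op U)) = 0 := rfl

lemma toAb_mul {U : C} (g h : (groupOfAb J A).obj (op U)) : toAb (g * h) = toAb g + toAb h := rfl

lemma toAb_map {U V : C} (f : V ⟶ U) (g : (groupOfAb J A).obj (op U)) :
    toAb ((groupOfAb J A).map f.op g) = A.obj.map f.op (toAb g) := rfl

namespace Torsor

/-- An equivariant map from a torsor under `A` to a sheaf `M` on which `A` acts by translations via
a morphism of sheaves of abelian groups. -/
structure EquivariantMap (P : Torsor J (groupOfAb J A)) (ι : A ⟶ M) where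
  val (V : C) (p : P.sheaf.obj.obj (op V)) : M.obj.obj (op V)
  map_val ⦃V W : C⦄ (f : W ⟶ V) (p : P.sheaf.obj.obj (op V)) :
    M.obj.map f.op (val V p) = val W (P.sheaf.obj.map f.op p)
  val_act (V : C) (p : P.sheaf.obj.obj (op V)) (g : (groupOfAb J A).obj (op V)) :
    val V (P.act p g) = val V p + ι.hom.app (op V) (toAb g)

variable {P Q : Torsor J (groupOfAb J A)}

/-- Composition of an equivariant map with a morphism of sheaves of abelian groups. -/
def EquivariantMap.comp {ι : A ⟶ M} (m : P.EquivariantMap ι) (u : M ⟶ M') :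
    P.EquivariantMap (ι ≫ u) where
  val V p := u.hom.app (op V) (m.val V p)
  map_val V W f p := by rw [← app_map, m.map_val]
  val_act V p g := by
    rw [m.val_act, map_add]
    rfl

/-- Translation of an equivariant map by a global section. -/
def EquivariantMap.sub {ι : A ⟶ M} (m : P.EquivariantMap ι) [UnivLE.{max u₁ v₁, w}]
    (t : constZ J ⟶ M) : P.EquivariantMap ι where
  val V p := m.val V p - globalSection t V
  map_val V W f p := by rw [map_sub, m.map_val, map_globalSection]
  val_act V p g := by rw [m.val_act, add_sub_right_comm]

/-- An invariant function takes only one value on each `P(V)` because the action is transitive; as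
`P` is locally non-empty, these values glue over every object. -/
lemma exists_globalSection_eq (P : Torsor J (groupOfAb J A)) [UnivLE.{max u₁ v₁, w}]
    (φ : ∀ V : C, P.sheaf.obj.obj (op V) → M.obj.obj (op V))
    (hφ : ∀ ⦃V W : C⦄ (f : W ⟶ V) (p : P.sheaf.obj.obj (op V)),
      M.obj.map f.op (φ V p) = φ W (P.sheaf.obj.map f.op p))
    (hφ' : ∀ (V : C) (p : P.sheaf.obj.obj (op V)) (g : (groupOfAb J A).obj (op V)),
      φ V (P.act p g) = φ V p) :
    ∃ s : constZ J ⟶ M, ∀ (V : C) (p : P.sheaf.obj.obj (op V)), φ V p = globalSection s V := by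
  have const (V : C) (p p' : P.sheaf.obj.obj (op V)) : φ V p = φ V p' := by
    rw [← P.act_diff p p', hφ']
  have hM := isSheaf_forget_ab M.property
  have key (V : C) : ∃ q : M.obj.obj (op V), ∀ ⦃W : C⦄ (f : W ⟶ V) (p : P.sheaf.obj.obj (op W)),
      M.obj.map f.op q = φ W p := by
    obtain ⟨R, hR, hne⟩ := P.locally_nonempty V
    obtain ⟨q, hq⟩ := exists_glue hM (V := V)
      (fun W f x ↦ ∃ p : P.sheaf.obj.obj (op W), φ W p = x)
      (by
        rintro W W' g f _ ⟨p, rfl⟩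
        exact ⟨_, (hφ g p).symm⟩)
      (by
        rintro W f _ _ ⟨p, rfl⟩ ⟨p', rfl⟩
        exact const W p p')
      R hR (fun W f hf ↦ ⟨_, (hne f hf).some, rfl⟩)
    exact ⟨q, fun W f p ↦ hq f _ ⟨p, rfl⟩⟩
  choose q hq using key
  obtain ⟨s, hs⟩ := exists_globalSection q (fun V W f ↦ by
    obtain ⟨R, hR, hne⟩ := P.locally_nonempty W
    refine ext_of_mem hM hR fun W' g hg ↦ ?_
    have h₁ := hq V (g ≫ f) (hne g hg).some
    rw [op_comp, Functor.map_comp_apply] at h₁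
    exact h₁.trans (hq W g _).symm)
  refine ⟨s, fun V p ↦ ?_⟩
  rw [hs, ← hq V (𝟙 V) p, op_id, Functor.map_id_apply]

variable {S : ShortComplex (Sheaf J AddCommGrpCat.{w})} {P : Torsor J (groupOfAb J S.X₁)}

lemma g_app_f_app (S : ShortComplex (Sheaf J AddCommGrpCat.{w})) (V : C)
    (a : S.X₁.obj.obj (op V)) : S.g.hom.app (op V) (S.f.hom.app (op V) a) = 0 :=
  congr_arg (fun f ↦ f.hom.app (op V) a) S.zero

variable [UnivLE.{max u₁ v₁, w}]

lemma EquivariantMap.exists_globalSection (m : P.EquivariantMap S.f) :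
    ∃ s : constZ J ⟶ S.X₃, ∀ V p, S.g.hom.app (op V) (m.val V p) = globalSection s V :=
  P.exists_globalSection_eq (fun V p ↦ S.g.hom.app (op V) (m.val V p))
    (fun V W f p ↦ by rw [← app_map, m.map_val])
    (fun V p g ↦ by rw [m.val_act, map_add, g_app_f_app, add_zero])

/-- The difference of two equivariant maps is invariant, so it is a global section `t` of `S.X₂`.
That `t` maps to `s - s'` is checked where `P` has sections. -/
lemma EquivariantMap.exists_sub_eq (m m' : P.EquivariantMap S.f) {s s' : constZ J ⟶ S.X₃}
    (h : ∀ V p, S.g.hom.app (op V) (m.val V p) = globalSection s V)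
    (h' : ∀ V p, S.g.hom.app (op V) (m'.val V p) = globalSection s' V) :
    ∃ t : constZ J ⟶ S.X₂, s - s' = t ≫ S.g := by
  obtain ⟨t, ht⟩ := P.exists_globalSection_eq (fun V p ↦ m.val V p - m'.val V p)
    (fun V W f p ↦ by rw [map_sub, m.map_val, m'.map_val])
    (fun V p g ↦ by rw [m.val_act, m'.val_act, add_sub_add_right_eq_sub])
  refine ⟨t, globalSection_ext fun V ↦ ?_⟩
  obtain ⟨R, hR, hne⟩ := P.locally_nonempty V
  refine ext_of_mem (isSheaf_forget_ab S.X₃.property) hR fun W f hf ↦ ?_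
  refine (map_globalSection _ f).trans (Eq.trans ?_ (map_globalSection _ f).symm)
  obtain ⟨p⟩ := hne f hf
  rw [globalSection_sub, globalSection_comp, ← ht W p, map_sub, h, h']

/-- The sections of the fibre over a global section of `S.X₃`. -/
@[ext]
structure Fiber (s : constZ J ⟶ S.X₃) (V : C) where
  val : S.X₂.obj.obj (op V)
  prop : S.g.hom.app (op V) val = globalSection s V

/-- Restriction of sections of a fibre. -/
def Fiber.restrict {s : constZ J ⟶ S.X₃} {V W : C} (f : W ⟶ V) (m : Fiber s V) : Fiber s W where
  val := S.X₂.obj.map f.op m.val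
  prop := by rw [app_map, m.prop, map_globalSection]

/-- Translation of sections of a fibre. -/
def Fiber.act {s : constZ J ⟶ S.X₃} {V : C} (m : Fiber s V)
    (g : (groupOfAb J S.X₁).obj (op V)) : Fiber s V where
  val := m.val + S.f.hom.app (op V) (toAb g)
  prop := by rw [map_add, m.prop, g_app_f_app, add_zero]

/-- The presheaf of sections of a fibre. -/
def fiberPresheaf (s : constZ J ⟶ S.X₃) : Cᵒᵖ ⥤ Type w where
  obj V := Fiber s V.unop
  map f := TypeCat.ofHom (Fiber.restrict f.unop)
  map_id V := by
    ext m
    exact Functor.map_id_apply S.X₂.obj V m.val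
  map_comp f g := by
    ext m
    exact Functor.map_comp_apply S.X₂.obj f g m.val

lemma fiberPresheaf_isSheaf (s : constZ J ⟶ S.X₃) : Presieve.IsSheaf J (fiberPresheaf s) := by
  intro V R hR x hx
  let x' ⦃W : C⦄ (f : W ⟶ V) (hf : R f) : Fiber s W := x f hf
  obtain ⟨y, hy, hy'⟩ := isSheaf_forget_ab S.X₂.property R hR (fun W f hf ↦ (x' f hf).val)
    (fun W₁ W₂ Z g₁ g₂ f₁ f₂ h₁ h₂ h ↦ congr_arg Fiber.val (hx g₁ g₂ h₁ h₂ h))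
  refine ⟨⟨y, ?_⟩, fun W f hf ↦ Fiber.ext (hy f hf), fun z hz ↦ Fiber.ext
    (hy' (Fiber.val z) fun W f hf ↦ congr_arg Fiber.val (hz f hf))⟩
  refine ext_of_mem (isSheaf_forget_ab S.X₃.property) hR fun W f hf ↦ ?_
  refine (app_map S.g f y).symm.trans (Eq.trans ?_ (map_globalSection s f).symm)
  exact (congr_arg (S.g.hom.app (op W)) (hy f hf)).trans (x' f hf).prop

/-- Freeness is injectivity of `S.f` on sections; transitivity is left exactness, since two points
of a fibre differ by a section killed by `S.g`. -/
lemma Fiber.act_bijective (hS : S.ShortExact) (s : constZ J ⟶ S.X₃) (V : C) :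
    Function.Bijective (fun z : Fiber s V × (groupOfAb J S.X₁).obj (op V) ↦
      (z.1, z.1.act z.2)) := by
  have := hS.mono_f
  constructor
  · rintro ⟨m, a⟩ ⟨m', b⟩ h
    obtain ⟨h₁, h₂⟩ := Prod.ext_iff.1 h
    obtain rfl : m = m' := h₁
    exact Prod.ext rfl (toAb.injective (app_injective S.f V (add_left_cancel
      (congr_arg Fiber.val h₂))))
  · rintro ⟨m, m'⟩
    obtain ⟨a, ha⟩ := exists_app_eq hS (m'.val - m.val) (by
      rw [map_sub, m.prop, m'.prop, sub_self])
    refine ⟨(m, toAb.symm a), Prod.ext rfl (Fiber.ext ?_)⟩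
    change m.val + S.f.hom.app (op V) (toAb (toAb.symm a)) = _
    rw [Equiv.apply_symm_apply, ha, add_sub_cancel]

/-- The fibre over a global section of `S.X₃` of the epimorphism of a short exact sequence `S`,
which is a torsor under `S.X₁`. -/
def fiber (hS : S.ShortExact) (s : constZ J ⟶ S.X₃) : Torsor J (groupOfAb J S.X₁) where
  sheaf := ⟨fiberPresheaf s, (isSheaf_iff_isSheaf_of_type J _).2 (fiberPresheaf_isSheaf s)⟩
  act {U} := Fiber.act (s := s) (V := U)
  act_one {U} m := Fiber.ext (by
    refine (congr_arg (Fiber.val m + ·) ?_).trans (add_zero _)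
    rw [toAb_one, map_zero])
  act_mul {U} m g h := Fiber.ext (by
    refine (congr_arg (Fiber.val m + ·) ?_).trans (add_assoc _ _ _).symm
    rw [toAb_mul, map_add])
  map_act {U V} f m g := Fiber.ext (by
    refine (map_add (S.X₂.obj.map f.op).hom _ _).trans ?_
    exact congr_arg (_ + ·) (app_map S.f f (toAb g)).symm)
  bijective U := Fiber.act_bijective hS s U
  locally_nonempty U := by
    have := hS.epi_g
    obtain ⟨R, hR, h⟩ := exists_local_lift S.g (globalSection s U)
    refine ⟨R, hR, fun V f hf ↦ ?_⟩
    obtain ⟨m, hm⟩ := h f hf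
    exact ⟨(⟨m, hm.trans (map_globalSection s f)⟩ : Fiber s V)⟩

/-- The inclusion of the fibre over a global section. -/
def fiberInclusion (hS : S.ShortExact) (s : constZ J ⟶ S.X₃) :
    (fiber hS s).EquivariantMap S.f where
  val _ p := Fiber.val p
  map_val _ _ _ _ := rfl
  val_act _ _ _ := rfl

lemma EquivariantMap.isIsomorphic_fiber (m : P.EquivariantMap S.f) (hS : S.ShortExact)
    (s : constZ J ⟶ S.X₃) (h : ∀ V p, S.g.hom.app (op V) (m.val V p) = globalSection s V) :
    P.IsIsomorphic (fiber hS s) :=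
  isIsomorphic_of_hom _ _ (fun V p ↦ (⟨m.val V p, h V p⟩ : Fiber s V))
    (fun _ _ f p ↦ Fiber.ext (m.map_val f p).symm)
    (fun V p g ↦ Fiber.ext (m.val_act V p g))

end Torsor

end AbelianTorsors

end

noncomputable section

/-! ### Functions on a torsor, and equivariant maps to injective sheaves -/

section FunctionSheaf

variable {C : Type u₁} [Category.{v₁} C] {J : GrothendieckTopology C}
  {A : Sheaf J AddCommGrpCat.{w}} (P : Torsor J (groupOfAb J A))

namespace Torsor

/-- The group of morphisms of sheaves from the restriction of `P` to `C / V` to the restriction of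
`A`. -/
def functionGroup (V : C) :
    AddSubgroup (∀ (W : C) (_ : W ⟶ V) (_ : P.sheaf.obj.obj (op W)), A.obj.obj (op W)) where
  carrier := {y | ∀ ⦃W W' : C⦄ (g : W' ⟶ W) (f : W ⟶ V) (p : P.sheaf.obj.obj (op W)),
    A.obj.map g.op (y W f p) = y W' (g ≫ f) (P.sheaf.obj.map g.op p)}
  zero_mem' _ _ _ _ _ := map_zero _
  add_mem' hy hz _ _ g f p := (map_add _ _ _).trans (congr_arg₂ _ (hy g f p) (hz g f p))
  neg_mem' hy _ _ g f p := (map_neg _ _).trans (congr_arg _ (hy g f p))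

/-- Restriction of functions on `P`. -/
def functionRestrict {V V' : C} (h : V' ⟶ V) : P.functionGroup V →+ P.functionGroup V' where
  toFun y := ⟨fun W f p ↦ y.1 W (f ≫ h) p, fun W W' g f p ↦ by
    dsimp only
    rw [y.2 g (f ≫ h) p, Category.assoc]⟩
  map_zero' := rfl
  map_add' _ _ := rfl

variable [UnivLE.{max u₁ v₁, w}]

instance (V : C) : Small.{w} (P.functionGroup V) := by
  have : UnivLE.{u₁, w} := UnivLE.trans.{u₁, max u₁ v₁, w}
  have : UnivLE.{v₁, w} := UnivLE.trans.{v₁, max u₁ v₁, w}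
  infer_instance

/-- The group of functions on `P`, in the smaller universe. -/
def functionEquiv (V : C) : P.functionGroup V ≃+ Shrink.{w} (P.functionGroup V) :=
  Shrink.addEquiv.symm

/-- The presheaf of functions on `P` with values in `A`. -/
def functionPresheaf : Cᵒᵖ ⥤ AddCommGrpCat.{w} where
  obj V := AddCommGrpCat.of (Shrink.{w} (P.functionGroup V.unop))
  map {V W} h := AddCommGrpCat.ofHom (((P.functionEquiv W.unop).toAddMonoidHom.comp
    (P.functionRestrict h.unop)).comp (P.functionEquiv V.unop).symm.toAddMonoidHom)
  map_id V := by
    refine ConcreteCategory.hom_ext _ _ fun y ↦ ?_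
    obtain ⟨y, rfl⟩ := (P.functionEquiv V.unop).surjective y
    refine congr_arg (P.functionEquiv V.unop) (Subtype.ext ?_)
    funext W f p
    change ((P.functionEquiv V.unop).symm (P.functionEquiv V.unop y)).1 W (f ≫ 𝟙 _) p = _
    rw [AddEquiv.symm_apply_apply, Category.comp_id]
  map_comp {V V' V''} f g := by
    refine ConcreteCategory.hom_ext _ _ fun y ↦ ?_
    obtain ⟨y, rfl⟩ := (P.functionEquiv V.unop).surjective y
    refine congr_arg (P.functionEquiv V''.unop) (Subtype.ext ?_)
    funext W h p
    change ((P.functionEquiv V.unop).symm (P.functionEquiv V.unop y)).1 W (h ≫ g.unop ≫ f.unop) p =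
      ((P.functionEquiv V'.unop).symm (P.functionEquiv V'.unop (P.functionRestrict f.unop
        ((P.functionEquiv V.unop).symm (P.functionEquiv V.unop y))))).1 W (h ≫ g.unop) p
    rw [AddEquiv.symm_apply_apply, AddEquiv.symm_apply_apply, ← Category.assoc]
    rfl

lemma functionPresheaf_map {V W : C} (f : W ⟶ V) (y : P.functionGroup V) :
    P.functionPresheaf.map f.op (P.functionEquiv V y) =
      P.functionEquiv W (P.functionRestrict f y) :=
  congr_arg (fun z ↦ P.functionEquiv W (P.functionRestrict f z))
    ((P.functionEquiv V).symm_apply_apply y)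

lemma functionPresheaf_isSheaf : Presheaf.IsSheaf J P.functionPresheaf := by
  refine isSheaf_ab_of_forget (isSheaf_of_equiv
    (homFamilies_isSheaf (B := P.sheaf.obj) (p := fun _ _ ↦ True)
      (isSheaf_forget_ab A.property) (fun _ _ _ _ _ _ ↦ trivial))
    (fun V ↦ Equiv.trans ⟨fun y ↦ ⟨fun W f p ↦ y.val f p, fun W W' g f p ↦ y.map_val g f p⟩,
      fun y ↦ ⟨fun W f p ↦ y.1 W f p, fun W W' g f p ↦ y.2 g f p, fun _ _ ↦ trivial⟩,
      fun _ ↦ rfl, fun _ ↦ rfl⟩ (P.functionEquiv V).toEquiv) ?_)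
  intro W V f y
  exact (P.functionPresheaf_map f ⟨fun W f p ↦ y.val f p, fun W W' g f p ↦ y.map_val g f p⟩).symm

/-- The sheaf of functions on `P` with values in `A`. -/
def functionSheaf : Sheaf J AddCommGrpCat.{w} := ⟨P.functionPresheaf, P.functionPresheaf_isSheaf⟩

/-- The constant functions on `P`. -/
def constFunction (V : C) : A.obj.obj (op V) →+ P.functionGroup V where
  toFun a := ⟨fun W f _ ↦ A.obj.map f.op a, fun W W' g f p ↦ by
    dsimp only
    rw [op_comp, Functor.map_comp_apply]⟩
  map_zero' := Subtype.ext (by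
    funext W f p
    exact map_zero _)
  map_add' a b := Subtype.ext (by
    funext W f p
    exact map_add _ _ _)

/-- The morphism from `A` to the sheaf of functions on `P` given by constant functions. -/
def toFunctionSheaf : A ⟶ P.functionSheaf where
  hom :=
    { app := fun V ↦ AddCommGrpCat.ofHom ((P.functionEquiv V.unop).toAddMonoidHom.comp
        (P.constFunction V.unop))
      naturality := fun V W f ↦ by
        ext a
        refine Eq.trans ?_ (P.functionPresheaf_map f.unop (P.constFunction V.unop a)).symm
        refine congr_arg (P.functionEquiv W.unop) (Subtype.ext ?_)
        funext W' g p
        exact (Functor.map_comp_apply A.obj f g.op a).symm }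

/-- A constant is recovered by evaluating at a section of `P`, and `P` has sections locally. -/
instance : Mono P.toFunctionSheaf := by
  have (V : Cᵒᵖ) : 
      Mono (((sheafToPresheaf J AddCommGrpCat.{w}).map P.toFunctionSheaf).app V) := by
    rw [AddCommGrpCat.mono_iff_injective]
    intro a b h
    have h' : P.constFunction V.unop a = P.constFunction V.unop b :=
      (P.functionEquiv V.unop).injective h
    obtain ⟨R, hR, hne⟩ := P.locally_nonempty V.unop
    refine ext_of_mem (isSheaf_forget_ab A.property) hR fun W f hf ↦ ?_
    exact congr_fun (congr_fun (congr_fun (congr_arg Subtype.val h') W) f) (hne f hf).some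
  have : Mono ((sheafToPresheaf J _).map P.toFunctionSheaf) := NatTrans.mono_of_mono_app _
  exact (sheafToPresheaf J _).mono_of_mono_map this

/-- The difference with a section of `P`, as a function on `P`. -/
def diffFunction {V : C} (p : P.sheaf.obj.obj (op V)) : P.functionGroup V :=
  ⟨fun _ f p' ↦ toAb (P.diff p' (P.sheaf.obj.map f.op p)), fun W W' g f p' ↦ by
    dsimp only
    rw [← toAb_map, P.map_diff, P.map_comp]⟩

/-- The equivariant map from `P` to the sheaf of functions on `P`. -/
def toFunctions : P.EquivariantMap P.toFunctionSheaf where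
  val V p := P.functionEquiv V (P.diffFunction p)
  map_val V W f p := (P.functionPresheaf_map f _).trans
    (congr_arg (P.functionEquiv W) (Subtype.ext (by
      funext W' g p'
      exact congr_arg (fun z ↦ toAb (P.diff p' z)) (P.map_comp g f p))))
  val_act V p g := by
    refine Eq.trans ?_ (map_add (P.functionEquiv V) (P.diffFunction p)
      (P.constFunction V (toAb g)))
    refine congr_arg (P.functionEquiv V) (Subtype.ext ?_)
    funext W f p'
    change toAb (P.diff p' (P.sheaf.obj.map f.op (P.act p g))) = _
    rw [P.map_act, P.diff_act]
    rfl

/-- Translating a section of `P` by `a` adds the constant `a` to its function, so any extension of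
`ι` from the constants to all functions turns `toFunctions` into the desired map. -/
lemma exists_equivariantMap {I : Sheaf J AddCommGrpCat.{w}} [Injective I] (ι : A ⟶ I) :
    Nonempty (P.EquivariantMap ι) := by
  have h := Injective.comp_factorThru ι P.toFunctionSheaf
  rw [← h]
  exact ⟨P.toFunctions.comp _⟩

end Torsor

end FunctionSheaf

end

noncomputable section

/-! ### The class of a torsor in `Ext¹(ℤ, A)` -/

section TorsorExt

open Abelian

variable {C : Type u₁} [Category.{v₁} C] {J : GrothendieckTopology C} [UnivLE.{max u₁ v₁, w}]

/-- The embedding of a sheaf of abelian groups into an injective sheaf, with its cokernel. -/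
abbrev injectiveSequence (A : Sheaf J AddCommGrpCat.{w}) :
    ShortComplex (Sheaf J AddCommGrpCat.{w}) :=
  ShortComplex.mk (Injective.ι A) (cokernel.π _) (cokernel.condition _)

lemma injectiveSequence_shortExact (A : Sheaf J AddCommGrpCat.{w}) :
    (injectiveSequence A).ShortExact :=
  ShortComplex.ShortExact.mk' (ShortComplex.exact_cokernel _) inferInstance inferInstance

/-- This is exactness of `Hom(X, S.X₂) ⟶ Hom(X, S.X₃) ⟶ Ext¹(X, S.X₁)` in the middle, applied to `s
- s'`. -/
lemma mk₀_comp_extClass_eq_iff {X : Sheaf J AddCommGrpCat.{w}}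
    {S : ShortComplex (Sheaf J AddCommGrpCat.{w})} (hS : S.ShortExact) (s s' : X ⟶ S.X₃) :
    (Ext.mk₀ s).comp hS.extClass (zero_add 1) = (Ext.mk₀ s').comp hS.extClass (zero_add 1) ↔
      ∃ t : X ⟶ S.X₂, s - s' = t ≫ S.g := by
  have h₀ : (Ext.mk₀ s).comp hS.extClass (zero_add 1) =
      (Ext.mk₀ (s - s')).comp hS.extClass (zero_add 1) +
        (Ext.mk₀ s').comp hS.extClass (zero_add 1) := by
    rw [← Ext.add_comp, ← Ext.mk₀_add, sub_add_cancel]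
  rw [h₀, add_eq_right]
  constructor
  · intro h
    obtain ⟨x, hx⟩ := Ext.covariant_sequence_exact₃ X hS _ (zero_add 1) h
    obtain ⟨t, rfl⟩ := (Ext.mk₀_bijective _ _).2 x
    rw [Ext.mk₀_comp_mk₀] at hx
    exact ⟨t, (Ext.mk₀_bijective _ _).1 hx.symm⟩
  · rintro ⟨t, ht⟩
    rw [ht, ← Ext.mk₀_comp_mk₀, Ext.comp_assoc_of_second_deg_zero, hS.comp_extClass, Ext.comp_zero]

lemma mk₀_comp_extClass_comp {X Y : Sheaf J AddCommGrpCat.{w}}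
    {S S' : ShortComplex (Sheaf J AddCommGrpCat.{w})} (hS : S.ShortExact) (hS' : S'.ShortExact)
    (f : S ⟶ S') (b : X ⟶ Y) (a : Y ⟶ S.X₃) :
    ((Ext.mk₀ b).comp ((Ext.mk₀ a).comp hS.extClass (zero_add 1)) (zero_add 1)).comp
      (Ext.mk₀ f.τ₁) (add_zero 1) =
        (Ext.mk₀ (b ≫ a ≫ f.τ₃)).comp hS'.extClass (zero_add 1) := by
  rw [Ext.comp_assoc_of_third_deg_zero, Ext.comp_assoc_of_third_deg_zero,
    ShortComplex.ShortExact.extClass_naturality hS hS' f, ← Ext.mk₀_comp_mk₀, ← Ext.mk₀_comp_mk₀,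
    Ext.comp_assoc_of_second_deg_zero, Ext.comp_assoc_of_second_deg_zero]

/-- The exact functor `F^*` carries the extension class of `S` to that of `F^* S`, and naturality of
extension classes along `f` carries this to the class of `S'`. -/
lemma derivedMap_mk₀_comp_extClass {D : Type u₂} [Category.{v₂} D] {K : GrothendieckTopology D}
    [UnivLE.{max u₂ v₂, w}] (F : D ⥤ C) [F.IsContinuous K J] [F.IsCocontinuous K J]
    {S : ShortComplex (Sheaf J AddCommGrpCat.{w})} (s : constZ J ⟶ S.X₃) (hS : S.ShortExact)
    {S' : ShortComplex (Sheaf K AddCommGrpCat.{w})} (hS' : S'.ShortExact)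
    (f : S.map (F.sheafPushforwardContinuous AddCommGrpCat.{w} K J) ⟶ S') :
    derivedMap F 1 f.τ₁ ((Ext.mk₀ s).comp hS.extClass (zero_add 1)) =
      (Ext.mk₀ (constZHom J K F ≫
        (F.sheafPushforwardContinuous AddCommGrpCat.{w} K J).map s ≫ f.τ₃)).comp
          hS'.extClass (zero_add 1) := by
  let Φ := F.sheafPushforwardContinuous AddCommGrpCat.{w} K J
  have h₁ : ((Ext.mk₀ s).comp hS.extClass (zero_add 1)).mapExactFunctor Φ =
      (Ext.mk₀ (Φ.map s)).comp (hS.map_of_exact Φ).extClass (zero_add 1) := by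
    rw [Ext.mapExactFunctor_comp, Ext.mapExactFunctor_mk₀, Ext.mapExactFunctor_extClass]
    rfl
  exact (congr_arg (fun z ↦ ((Ext.mk₀ (constZHom J K F)).comp z (zero_add 1)).comp
    (Ext.mk₀ f.τ₁) (add_zero 1)) h₁).trans
      (mk₀_comp_extClass_comp (S := S.map Φ) (hS.map_of_exact Φ) hS' f (constZHom J K F) (Φ.map s))

namespace Torsor

variable {A : Sheaf J AddCommGrpCat.{w}}

/-- The torsor `P` is the fibre of an injective embedding of `A` over a global section of the
cokernel whose image under the connecting homomorphism is the class `x`. -/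
def HasClass (P : Torsor J (groupOfAb J A)) (x : A.H 1) : Prop :=
  ∃ (m : P.EquivariantMap (injectiveSequence A).f) (s : constZ J ⟶ (injectiveSequence A).X₃),
    (∀ V p, (injectiveSequence A).g.hom.app (op V) (m.val V p) = globalSection s V) ∧
      (Ext.mk₀ s).comp (injectiveSequence_shortExact A).extClass (zero_add 1) = x

lemma exists_hasClass (P : Torsor J (groupOfAb J A)) : ∃ x, P.HasClass x := by
  obtain ⟨m⟩ := P.exists_equivariantMap (injectiveSequence A).f
  obtain ⟨s, hs⟩ := EquivariantMap.exists_globalSection (S := injectiveSequence A) m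
  exact ⟨_, m, s, hs, rfl⟩

/-- `Ext¹(ℤ, I) = 0`, so every class is the connecting image of a global section of `I/A`; the
torsor is the fibre over that section. -/
lemma exists_torsor_hasClass (x : A.H 1) : ∃ P : Torsor J (groupOfAb J A), P.HasClass x := by
  obtain ⟨y, hy⟩ := Ext.covariant_sequence_exact₁ _ (injectiveSequence_shortExact A) x
    (Ext.eq_zero_of_injective _) (zero_add 1)
  obtain ⟨s, rfl⟩ := (Ext.mk₀_bijective _ _).2 y
  exact ⟨fiber (injectiveSequence_shortExact A) s, fiberInclusion _ s, s, fun V p ↦ Fiber.prop p,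
    hy⟩

variable {P Q : Torsor J (groupOfAb J A)} {x y : A.H 1}

lemma HasClass.of_isIsomorphic (h : P.HasClass x) (e : Q.IsIsomorphic P) : Q.HasClass x := by
  obtain ⟨m, s, hs, hx⟩ := h
  obtain ⟨e, he⟩ := e
  let m' : Q.EquivariantMap (injectiveSequence A).f :=
    { val := fun V p ↦ m.val V (e.hom.hom.app (op V) p)
      map_val := fun V W f p ↦ by
        rw [m.map_val]
        exact congr_arg (m.val W) (ConcreteCategory.congr_hom (e.hom.hom.naturality f.op) p).symm
      val_act := fun V p g ↦ by rw [he, m.val_act] }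
  exact ⟨m', s, fun V p ↦ hs V _, hx⟩

lemma HasClass.eq (h : P.HasClass x) (h' : P.HasClass y) : x = y := by
  obtain ⟨m, s, hs, rfl⟩ := h
  obtain ⟨m', s', hs', rfl⟩ := h'
  exact (mk₀_comp_extClass_eq_iff _ _ _).2 (m.exists_sub_eq m' hs hs')

lemma HasClass.isIsomorphic (h : P.HasClass x) (h' : Q.HasClass x) : P.IsIsomorphic Q := by
  obtain ⟨m, s, hs, hx⟩ := h
  obtain ⟨m', s', hs', hx'⟩ := h'
  obtain ⟨t, ht⟩ := (mk₀_comp_extClass_eq_iff _ _ _).1 (hx.trans hx'.symm)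
  -- Subtracting `t` moves the global section below `m` from `s` to `s - (s - s') = s'`, so both
  -- torsors are isomorphic to the fibre over `s'`.
  refine (isIsomorphic_equivalence J _).trans ((m.sub t).isIsomorphic_fiber
    (injectiveSequence_shortExact A) s' fun V p ↦ ?_) ((isIsomorphic_equivalence J _).symm
      (m'.isIsomorphic_fiber (injectiveSequence_shortExact A) s' hs'))
  change (injectiveSequence A).g.hom.app (op V) (m.val V p - globalSection t V) = _
  rw [map_sub, hs, ← globalSection_comp, ← ht, globalSection_sub, sub_sub_cancel]

variable {D : Type u₂} [Category.{v₂} D] {K : GrothendieckTopology D} [UnivLE.{max u₂ v₂, w}]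
  {A' : Sheaf K AddCommGrpCat.{w}} (F : D ⥤ C) [F.IsContinuous K J] [F.IsCocontinuous K J]

lemma HasClass.pullback (h : P.HasClass x) (φ : F.op ⋙ groupOfAb J A ≅ groupOfAb K A')
    (φ' : (F.sheafPushforwardContinuous AddCommGrpCat.{w} K J).obj A ⟶ A')
    (hφ : ∀ (V : D) (g : (groupOfAb J A).obj (op (F.obj V))),
      toAb (φ.hom.app (op V) g) = φ'.hom.app (op V) (toAb g)) :
    (P.pullback (K := K) F φ).HasClass (derivedMap F 1 φ' x) := by
  obtain ⟨m, s, hs, rfl⟩ := h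
  let Φ := F.sheafPushforwardContinuous AddCommGrpCat.{w} K J
  have hS := (injectiveSequence_shortExact A).map_of_exact Φ
  have hS' := injectiveSequence_shortExact A'
  have := hS.mono_f
  have := hS.epi_g
  -- Injectivity of the target is what gives `u`: `Φ` keeps the embedding of `A` a monomorphism. The
  -- map `v` is then induced on cokernels, and `u` composed with `m` is an equivariant map lying
  -- over the image under `v` of the pulled back section.
  let u : Φ.obj (injectiveSequence A).X₂ ⟶ (injectiveSequence A').X₂ :=
    Injective.factorThru (φ' ≫ (injectiveSequence A').f) (Φ.map (injectiveSequence A).f)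
  have hu : Φ.map (injectiveSequence A).f ≫ u = φ' ≫ (injectiveSequence A').f :=
    Injective.comp_factorThru _ _
  let v : Φ.obj (injectiveSequence A).X₃ ⟶ (injectiveSequence A').X₃ :=
    hS.exact.desc (u ≫ (injectiveSequence A').g) (by
      refine (Category.assoc _ _ _).symm.trans ?_
      refine (congr_arg (· ≫ (injectiveSequence A').g) hu).trans ?_
      rw [Category.assoc, (injectiveSequence A').zero, comp_zero]
      rfl)
  have hv : Φ.map (injectiveSequence A).g ≫ v = u ≫ (injectiveSequence A').g := hS.exact.g_desc _ _
  let f : (injectiveSequence A).map Φ ⟶ injectiveSequence A' :=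
    { τ₁ := φ', τ₂ := u, τ₃ := v, comm₁₂ := hu.symm, comm₂₃ := hv.symm }
  have huv (V : D) (z : (injectiveSequence A).X₂.obj.obj (op (F.obj V))) :
      (injectiveSequence A').g.hom.app (op V) (u.hom.app (op V) z) =
        v.hom.app (op V) ((injectiveSequence A).g.hom.app (op (F.obj V)) z) :=
    (congr_arg (fun f ↦ f.hom.app (op V) z) hv).symm
  have hu' (V : D) (z : A.obj.obj (op (F.obj V))) :
      u.hom.app (op V) ((injectiveSequence A).f.hom.app (op (F.obj V)) z) =
        (injectiveSequence A').f.hom.app (op V) (φ'.hom.app (op V) z) :=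
    congr_arg (fun f ↦ f.hom.app (op V) z) hu
  let m' : (P.pullback (K := K) F φ).EquivariantMap (injectiveSequence A').f :=
    { val := fun V p ↦ u.hom.app (op V) (m.val (F.obj V) p)
      map_val := fun V W f p ↦ (app_map u f _).symm.trans
        (congr_arg (u.hom.app (op W)) (m.map_val (F.map f) p))
      val_act := fun V p g ↦ by
        refine (congr_arg (u.hom.app (op V)) (m.val_act (F.obj V) p (φ.inv.app (op V) g))).trans
          ((map_add (u.hom.app (op V)).hom _ _).trans (congr_arg (_ + ·) ?_))
        refine (hu' V _).trans (congr_arg ((injectiveSequence A').f.hom.app (op V)) ?_)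
        exact (hφ V _).symm.trans (congr_arg toAb (ConcreteCategory.congr_hom (φ.inv_hom_id_app (op V)) g)) }
  refine ⟨m', constZHom J K F ≫ Φ.map s ≫ v, fun V p ↦ ?_, ?_⟩
  · refine (huv V _).trans ((congr_arg (v.hom.app (op V)) (hs (F.obj V) p)).trans ?_)
    rw [← Category.assoc, globalSection_comp]
    exact congr_arg (v.hom.app (op V)) (globalSection_pullback F s V).symm
  · exact (derivedMap_mk₀_comp_extClass F s (injectiveSequence_shortExact A) hS' f).symm

end Torsor

/-- The class in derived functor cohomology of an isomorphism class of torsors. -/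
def TorsorClasses.toH (A : Sheaf J AddCommGrpCat.{w}) : TorsorClasses J (groupOfAb J A) → A.H 1 :=
  Quotient.lift (fun P ↦ P.exists_hasClass.choose) fun P Q e ↦
    P.exists_hasClass.choose_spec.eq (Q.exists_hasClass.choose_spec.of_isIsomorphic e)

lemma TorsorClasses.toH_mk {A : Sheaf J AddCommGrpCat.{w}} {P : Torsor J (groupOfAb J A)}
    {x : A.H 1} (h : P.HasClass x) : TorsorClasses.toH A (Quotient.mk _ P) = x :=
  P.exists_hasClass.choose_spec.eq h

lemma TorsorClasses.toH_bijective (A : Sheaf J AddCommGrpCat.{w}) :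
    Function.Bijective (TorsorClasses.toH A) := by
  constructor
  · rintro ⟨P⟩ ⟨Q⟩ h
    have hQ := Q.exists_hasClass.choose_spec
    exact Quotient.sound (P.exists_hasClass.choose_spec.isIsomorphic
      ((show P.exists_hasClass.choose = Q.exists_hasClass.choose from h) ▸ hQ))
  · intro x
    obtain ⟨P, hP⟩ := Torsor.exists_torsor_hasClass x
    exact ⟨Quotient.mk _ P, TorsorClasses.toH_mk hP⟩

lemma TorsorClasses.toH_map {D : Type u₂} [Category.{v₂} D] {K : GrothendieckTopology D}
    [UnivLE.{max u₂ v₂, w}] {A : Sheaf J AddCommGrpCat.{w}}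
    {A' : Sheaf K AddCommGrpCat.{w}} (F : D ⥤ C) [F.IsContinuous K J] [F.IsCocontinuous K J]
    (φ : F.op ⋙ groupOfAb J A ≅ groupOfAb K A')
    (φ' : (F.sheafPushforwardContinuous AddCommGrpCat.{w} K J).obj A ⟶ A')
    (hφ : ∀ (V : D) (g : (groupOfAb J A).obj (op (F.obj V))),
      toAb (φ.hom.app (op V) g) = φ'.hom.app (op V) (toAb g))
    (P : TorsorClasses J (groupOfAb J A)) :
    TorsorClasses.toH A' (TorsorClasses.map (K := K) F φ P) =
      derivedMap F 1 φ' (TorsorClasses.toH A P) := by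
  obtain ⟨P⟩ := P
  exact TorsorClasses.toH_mk (P.exists_hasClass.choose_spec.pullback F φ φ' hφ)

end TorsorExt

end

noncomputable section

/-! ### The derived functor comparison for fibred categories -/

section FibredDerived

variable {𝒮 : Type u₁} [Category.{v₁} 𝒮] (J : GrothendieckTopology 𝒮)
  (𝒯 : BasedCategory.{v₂, u₂} 𝒮) [IsFibredInGroupoids 𝒯.p]

/-- The class in derived functor cohomology of an isomorphism class of torsors over a fibred
category. -/
def FibTorsorClasses.toH (hw : UnivLE.{max u₂ v₂, w}) (G : Sheaf J AddCommGrpCat.{w}) :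
    FibTorsorClasses J 𝒯 (groupOfAb J G) → FibH J 𝒯 G 1 :=
  TorsorClasses.toH (coeffAb J 𝒯 G)

lemma FibTorsorClasses.toH_bijective (hw : UnivLE.{max u₂ v₂, w})
    (G : Sheaf J AddCommGrpCat.{w}) : Function.Bijective (FibTorsorClasses.toH J 𝒯 hw G) :=
  TorsorClasses.toH_bijective (coeffAb J 𝒯 G)

lemma FibTorsorClasses.toH_map {𝒯' : BasedCategory.{v₃, u₃} 𝒮} [IsFibredInGroupoids 𝒯'.p]
    (f : 𝒯' ⥤ᵇ 𝒯) (hw : UnivLE.{max u₂ v₂, w}) (hw' : UnivLE.{max u₃ v₃, w})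
    (G : Sheaf J AddCommGrpCat.{w}) (P : FibTorsorClasses J 𝒯 (groupOfAb J G)) :
    FibTorsorClasses.toH J 𝒯' hw' G (FibTorsorClasses.map J f (groupOfAb J G) P) =
      FibH.map J f G 1 (FibTorsorClasses.toH J 𝒯 hw G P) :=
  TorsorClasses.toH_map (A := coeffAb J 𝒯 G) (A' := coeffAb J 𝒯' G) f.toFunctor
    (coeffIso (groupOfAb J G) f) (coeffAbIso J f G).hom (fun _ _ ↦ rfl) P

end FibredDerived

section SchemesDerived

variable (τ : Topo) {S : Scheme.{u}}
  (𝒳 : BasedCategory.{v₁, u₁} (Over S)) (𝒜 : BasedCategory.{v₂, u₂} (Over S))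
  [IsFibredInGroupoids 𝒳.p] [IsFibredInGroupoids 𝒜.p]

lemma torsorObstruction_eq_derivedObstruction
    [hwX : UnivLE.{max u₁ v₁, w}] [hwA : UnivLE.{max u₂ v₂, w}] [hwS : UnivLE.{u + 1, w}]
    (G : Sheaf (τ.big S) AddCommGrpCat.{w}) :
    torsorObstruction τ 𝒳 𝒜 (groupOfAb (τ.big S) G) = derivedObstruction τ 𝒳 𝒜 G :=
  obstruction_eq
    (FibTorsorClasses.toH (τ.big S) 𝒳 hwX G) (FibTorsorClasses.toH (τ.big S) 𝒜 hwA G)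
    (FibTorsorClasses.toH (τ.big S) (base (Over S)) hwS G)
    (FibTorsorClasses.toH_bijective (τ.big S) 𝒳 hwX G).2
    (FibTorsorClasses.toH_bijective (τ.big S) 𝒜 hwA G).1
    (FibTorsorClasses.toH_bijective (τ.big S) (base (Over S)) hwS G).2
    (fun x A ↦ FibTorsorClasses.toH_map (τ.big S) 𝒳 x hwX hwA G A)
    (fun A ↦ FibTorsorClasses.toH_map (τ.big S) _ (structureMap 𝒜) hwS hwA G A)

end SchemesDerived

end

end FibObs

theorem proposition3p9 :
    (∀ (τ : FibObs.Topo) (S : Scheme.{u})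
      (𝒳 : BasedCategory.{v₁, u₁} (Over S)) (𝒜 : BasedCategory.{v₂, u₂} (Over S))
      [FibObs.IsFibredInGroupoids 𝒳.p] [FibObs.IsFibredInGroupoids 𝒜.p]
      [FibObs.IsRepresentable 𝒳] [FibObs.IsRepresentable 𝒜]
      [UnivLE.{max u₁ v₁, w}] [UnivLE.{max u₂ v₂, w}] [UnivLE.{u + 1, w}]
      (G : Sheaf (τ.big S) GrpCat.{w}),
      FibObs.torsorObstruction τ 𝒳 𝒜 G.obj = FibObs.cechObstruction τ 𝒳 𝒜 G.obj) ∧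
    (∀ (k : Type u) [Field k] [NumberField k] (X : Over (Spec (.of k)))
      [IsSeparated X.hom] [LocallyOfFiniteType X.hom] [QuasiCompact X.hom],
      FibObs.descSet k X ⊆ FibObs.classicalDescSet k X) ∧
    (∀ (τ : FibObs.Topo) (S : Scheme.{u})
      (𝒳 : BasedCategory.{v₁, u₁} (Over S)) (𝒜 : BasedCategory.{v₂, u₂} (Over S))
      [FibObs.IsFibredInGroupoids 𝒳.p] [FibObs.IsFibredInGroupoids 𝒜.p]
      [UnivLE.{max u₁ v₁, w}] [UnivLE.{max u₂ v₂, w}] [UnivLE.{u + 1, w}]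
      (G : Sheaf (τ.big S) AddCommGrpCat.{w}),
      FibObs.torsorObstruction τ 𝒳 𝒜 (FibObs.groupOfAb (τ.big S) G) =
        FibObs.derivedObstruction τ 𝒳 𝒜 G) :=
  ⟨fun τ _ 𝒳 𝒜 _ _ _ _ _ _ _ G ↦ FibObs.torsorObstruction_eq_cechObstruction τ 𝒳 𝒜 G.property,
    fun k _ _ X _ _ _ ↦ FibObs.descSet_subset_classicalDescSet k X,
    fun τ _ 𝒳 𝒜 _ _ _ _ _ G ↦ FibObs.torsorObstruction_eq_derivedObstruction τ 𝒳 𝒜 G⟩
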